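/- **Setting.** Let $q=e^{\eta}$ with $\operatorname{Re}\eta<0$, put $q^x=e^{\eta x}$ for $x\in\mathbb C$, and let $p\in\mathbb C$ with $0<|p|<1$. For $c\in\mathbb C$ put $p^*=pq^{-2c}$ and assume $|p^*|<1$. Let $(z;p)_\infty=\prod_{n\ge0}(1-zp^n)$, $(z;p_1,p_2)_\infty=\prod_{m,n\ge 0}(1-zp_1^mp_2^n)$, $\Theta_p(z)=(z;p)_\infty(p/z;p)_\infty(p;p)_\infty$. The dynamical parameter $\lambda$ is represented by $s\in\mathbb C$, with $w=q^{2s}$, $w^{1/2}=q^{s}$; on $V=\mathbb C^2$ with $\sigma_z=\mathrm{diag}(1,-1)$ the shift $\lambda\mapsto\lambda+\sigma_z$ means $s\mapsto s\pm1$ on the two basis vectors, and $e^{k\sigma_z\partial}$ is the diagonal matrix of the shift operators $f(s)\mapsto f(s\pm k)$. In the basis $e_1\otimes e_1,e_1\otimes e_2,e_2\otimes e_1,e_2\otimes e_2$ of $V\otimes V$ let $$R(z,\lambda)=\rho(z)\begin{pmatrix}1&0&0&0\\0&b&\mathsf c&0\\0&\bar{\mathsf c}&\bar b&0\\0&0&0&1\end{pmatrix},$$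 $$b=\tfrac{\Theta_p(q^2w)\Theta_p(z)}{\Theta_p(w)\Theta_p(q^2z)},\quad \bar b=\tfrac{\Theta_p(q^2w^{-1})\Theta_p(z)}{\Theta_p(w^{-1})\Theta_p(q^2z)},\quad \mathsf c=\tfrac{\Theta_p(q^2)\Theta_p(wz)}{\Theta_p(w)\Theta_p(q^2z)},\quad \bar{\mathsf c}=\tfrac{\Theta_p(q^2)\Theta_p(w^{-1}z)}{\Theta_p(w^{-1})\Theta_p(q^2z)},$$ $$\rho(z)=q^{-1/2}\frac{(q^2z;p,q^4)_\infty^2\,(pz^{-1};p,q^4)_\infty\,(pq^4z^{-1};p,q^4)_\infty}{(pq^2z^{-1};p,q^4)_\infty^2\,(z;p,q^4)_\infty\,(q^4z;p,q^4)_\infty}.$$ Let $W\subset\mathbb C$ (the set of weights of the Cartan generator $h$). Call $z$ regular for $p$ if $z\notin q^{\mathbb Z}p^{\mathbb Z}$. Call $s$ regular if $q^{2(s+m)}\notin p^{\mathbb Z}$ and $q^{2(s+\mu+m)}\notin (p^*)^{\mathbb Z}$ for all $m\in\mathbb Z$ and $\mu\in W$. The dynamical elliptic algebra $\mathcal B_{q,\lambda}(\widehat{gl}_2)$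 at central charge $c$ is the unital associative $\mathbb C$-algebra generated by the functions $f(h)$, $f:\mathbb C\to\mathbb C$ (with pointwise operations, constants being scalars, and $f(h)=g(h)$ if $f=g$ on $W$), and by the entries of $2\times2$ matrices $L^\pm(z,\lambda)$ and of their inverses ($z\in\mathbb C^\times$, $s\in\mathbb C$), with the relations $f(h)\,L^\pm_{ij}=L^\pm_{ij}\,f(h+\sigma_j-\sigma_i)$, where $\sigma_1=1$, $\sigma_2=-1$ (that is, $[\sigma_z+h,L^\pm(z,\lambda)]=0$), and $$R_{12}(z_1/z_2,\lambda+h)L_1^\pm(z_1,\lambda)L_2^\pm(z_2,\lambda+\sigma_z^{(1)})=L_2^\pm(z_2,\lambda)L_1^\pm(z_1,\lambda+\sigma_z^{(2)})R_{12}(z_1/z_2,\lambda),$$ $$R_{12}(q^cz_1/z_2,\lambda+h)L_1^+(z_1,\lambda)L_2^-(z_2,\lambda+\sigma_z^{(1)})=L_2^-(z_2,\lambda)L_1^+(z_1,\lambda+\sigma_z^{(2)})R_{12}(q^{-c}z_1/z_2,\lambda),$$ imposed whenever $s$ is regular and the spectral arguments of the $R$-matrices on the left are regular for $p^*$ and of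 those on the right regular for $p$ (in the first relation $z_1/z_2$ is regular for both). In $R_{12}(\cdot,\lambda+h)$ the shift by $h$ replaces $s$ by $s+h$ and the nome $p$ by $p^*$. Let $\Upsilon(\lambda)=w^{-1/2}\Theta_p(w)$, $N(\lambda)=\Upsilon(\lambda-\sigma_z)/\Upsilon(\lambda)$ (a diagonal matrix), and $$t(z,\lambda)=\operatorname{tr}\big(N(\lambda)e^{-\sigma_z\partial}L^+(q^{-c}z,\lambda)^{-1}L^-(z,\lambda)e^{\sigma_z\partial}\big),$$ $$t^*(z,\lambda)=\operatorname{tr}\big(N(\lambda)e^{-\sigma_z\partial}L^-(q^{c}z,\lambda)^{-1}L^+(z,\lambda)e^{\sigma_z\partial}\big);$$ these difference operators are multiplications by functions of $\lambda$ with values in the algebra. **Theorem.** For all $z_1,z_2\in\mathbb C^\times$ with $z_1/z_2\notin q^{\mathbb Z}p^{\mathbb Z}$ and all regular $s$, $$t(z_1,\lambda)\,L^\pm(z_2,\lambda)=L^\pm(z_2,\lambda)\,t(z_1,\lambda+\sigma_z)\qquad\text{when } c=-2,$$ $$t^*(z_1,\lambda)\,L^\pm(z_2,\lambda)=L^\pm(z_2,\lambda)\,t^*(z_1,\lambda+\sigma_z)\qquad\text{when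 } c=2,$$ where $t^{(*)}(z_1,\lambda+\sigma_z)$ is the diagonal matrix with entries $t^{(*)}(z_1,\cdot)$ at $s+1$ and $s-1$. -/

import Mathlib

open Matrix

noncomputable section

namespace EllipticB

/-! ### Parameters and special functions

The deformation parameter is `q = exp η`, and `q ^ x` always means `exp (η * x)`; this fixes the
branches of `q ^ c`, `q ^ (1/2)`, `w = q ^ (2 s)` and `w ^ (1/2) = q ^ s`.  The dynamical parameter
`λ` enters through the complex number `s`; the shift `λ + σ_z` is `s ↦ s ± 1`,
that is `w ↦ q ^ (± 2) w`, on the two basis vectors of `V = ℂ ^ 2`. -/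

/-- `q ^ x`, as a nonzero complex number. -/
def qpow (η x : ℂ) : ℂˣ := Units.mk0 (Complex.exp (η * x)) (Complex.exp_ne_zero _)

/-- `(z; p)_∞`. -/
def poch (z p : ℂ) : ℂ := ∏' n : ℕ, (1 - z * p ^ n)

/-- `(z; p₁, p₂)_∞`. -/
def poch₂ (z p₁ p₂ : ℂ) : ℂ := ∏' n : ℕ × ℕ, (1 - z * p₁ ^ n.1 * p₂ ^ n.2)

/-- The Jacobi theta function `Θ_p(z) = (z; p)_∞ (p / z; p)_∞ (p; p)_∞`. -/
def theta (p z : ℂ) : ℂ := poch z p * poch (p / z) p * poch p p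

/-- The normalization factor `ρ(z)` of the `R`-matrix with elliptic nome `p`. -/
def rho (η p z : ℂ) : ℂ :=
  let q : ℂ → ℂ := fun x => qpow η x
  q (-(1 / 2)) *
    (poch₂ (q 2 * z) p (q 4) ^ 2 * poch₂ (p / z) p (q 4) * poch₂ (p * q 4 / z) p (q 4)) /
    (poch₂ (p * q 2 / z) p (q 4) ^ 2 * poch₂ z p (q 4) * poch₂ (q 4 * z) p (q 4))

/-- The eigenvalues `1, -1` of `σ_z`. -/
def sig : Fin 2 → ℂ := ![1, -1]

/-- The dynamical elliptic `R`-matrix `R(z, λ)` with nome `p`, `w = q ^ (2 s)`, on `V ⊗ V`.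
The pair `(a, b)` stands for the basis vector `e_a ⊗ e_b`; these are numbered
`(0,0), (0,1), (1,0), (1,1)`. -/
def Rmat (η p z s : ℂ) : Matrix (Fin 2 × Fin 2) (Fin 2 × Fin 2) ℂ :=
  let q2 : ℂ := qpow η 2
  let w : ℂ := qpow η (2 * s)
  let Θ : ℂ → ℂ := theta p
  let b := Θ (q2 * w) * Θ z / (Θ w * Θ (q2 * z))
  let b' := Θ (q2 * w⁻¹) * Θ z / (Θ w⁻¹ * Θ (q2 * z))
  let c := Θ q2 * Θ (w * z) / (Θ w * Θ (q2 * z))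
  let c' := Θ q2 * Θ (w⁻¹ * z) / (Θ w⁻¹ * Θ (q2 * z))
  rho η p z •
    (!![1, 0, 0, 0;
        0, b, c, 0;
        0, c', b', 0;
        0, 0, 0, 1] : Matrix (Fin 4) (Fin 4) ℂ).submatrix finProdFinEquiv finProdFinEquiv

/-- The shifted nome `p* = p q ^ (-2 c)`. -/
def pstar (η p c : ℂ) : ℂ := p * qpow η (-2 * c)

/-- `z ∉ q ^ ℤ p ^ ℤ`: off this set the factors of `R(z, λ)` that depend on `z` have
neither zeros nor poles, so that `R(z, λ)` is regular and invertible. -/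
def SpecReg (η p z : ℂ) : Prop := ∀ m n : ℤ, z ≠ qpow η m * p ^ n

/-- `w = q ^ (2 s) ∉ q ^ (2 ℤ) p ^ ℤ`: at such an `s`, and at all its shifts by integers,
`Θ_p(w) ≠ 0`. -/
def DynReg (η p s : ℂ) : Prop := ∀ m n : ℤ, (qpow η (2 * (s + m)) : ℂ) ≠ p ^ n

/-! ### The algebra -/

/-- The label of the two Lax matrices `L⁺`, `L⁻`. -/
inductive Sgn
  | plus
  | minus

/-- Generators: the entries of `L^±(z, λ)` and of `L^±(z, λ)⁻¹`, and the functions `f(h)` of the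
Cartan generator `h`. -/
inductive Gen
  | L (ε : Sgn) (i j : Fin 2) (z : ℂˣ) (s : ℂ)
  | Linv (ε : Sgn) (i j : Fin 2) (z : ℂˣ) (s : ℂ)
  | fh (f : ℂ → ℂ)

/-- The entries of the Lax matrices, in the free algebra. -/
def gL (ε : Sgn) (i j : Fin 2) (z : ℂˣ) (s : ℂ) : FreeAlgebra ℂ Gen :=
  FreeAlgebra.ι ℂ (Gen.L ε i j z s)

/-- The entries of the inverse Lax matrices, in the free algebra. -/
def gLinv (ε : Sgn) (i j : Fin 2) (z : ℂˣ) (s : ℂ) : FreeAlgebra ℂ Gen :=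
  FreeAlgebra.ι ℂ (Gen.Linv ε i j z s)

/-- `f(h)`, in the free algebra. -/
def gfh (f : ℂ → ℂ) : FreeAlgebra ℂ Gen := FreeAlgebra.ι ℂ (Gen.fh f)

/-- The entry at `(a, b), (c, d)` of `R₁₂(x, λ + h) L^ε₁(z₁, λ) L^ε'₂(z₂, λ + σ_z⁽¹⁾)`.  The shift by
`h` replaces `s` by `s + h` and the nome `p` by `ps = p*`. -/
def rllLeft (η ps x : ℂ) (ε ε' : Sgn) (z₁ z₂ : ℂˣ) (s : ℂ) (a b c d : Fin 2) :
    FreeAlgebra ℂ Gen :=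
  ∑ e, ∑ f, gfh (fun μ => Rmat η ps x (s + μ) (a, b) (e, f)) *
    gL ε e c z₁ s * gL ε' f d z₂ (s + sig c)

/-- The entry at `(a, b), (c, d)` of `L^ε'₂(z₂, λ) L^ε₁(z₁, λ + σ_z⁽²⁾) R₁₂(x, λ)`. -/
def rllRight (η p x : ℂ) (ε ε' : Sgn) (z₁ z₂ : ℂˣ) (s : ℂ) (a b c d : Fin 2) :
    FreeAlgebra ℂ Gen :=
  ∑ e, ∑ f, Rmat η p x s (e, f) (c, d) • (gL ε' b f z₂ s * gL ε a e z₁ (s + sig f))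

/-- The defining relations at central charge `c`.  The set `W` is the set of weights of `h`: a
function of `h` is determined by its values on `W`.  The `RLL` relations are imposed at those values
of the parameters where all the `R`-matrices in them are regular. -/
inductive Rel (η p c : ℂ) (W : Set ℂ) : FreeAlgebra ℂ Gen → FreeAlgebra ℂ Gen → Prop
  | fh_add (f g : ℂ → ℂ) : Rel η p c W (gfh (fun μ => f μ + g μ)) (gfh f + gfh g)
  | fh_mul (f g : ℂ → ℂ) : Rel η p c W (gfh (fun μ => f μ * g μ)) (gfh f * gfh g)
  | fh_const (a : ℂ) : Rel η p c W (gfh (fun _ => a)) (algebraMap ℂ _ a)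
  | fh_congr (f g : ℂ → ℂ) (hfg : Set.EqOn f g W) : Rel η p c W (gfh f) (gfh g)
  /-- `[σ_z + h, L^ε(z, λ)] = 0`, for all functions of `h` in place of `h`. -/
  | weight (f : ℂ → ℂ) (ε : Sgn) (i j : Fin 2) (z : ℂˣ) (s : ℂ) :
      Rel η p c W (gfh f * gL ε i j z s)
        (gL ε i j z s * gfh (fun μ => f (μ + sig j - sig i)))
  | mul_inv (ε : Sgn) (i j : Fin 2) (z : ℂˣ) (s : ℂ) :
      Rel η p c W (∑ k, gL ε i k z s * gLinv ε k j z s) (if i = j then 1 else 0)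
  | inv_mul (ε : Sgn) (i j : Fin 2) (z : ℂˣ) (s : ℂ) :
      Rel η p c W (∑ k, gLinv ε i k z s * gL ε k j z s) (if i = j then 1 else 0)
  /-- `R₁₂(z₁/z₂, λ+h) L^±₁(z₁, λ) L^±₂(z₂, λ+σ_z⁽¹⁾) = L^±₂(z₂, λ) L^±₁(z₁, λ+σ_z⁽²⁾) R₁₂(z₁/z₂, λ)` -/
  | rll (ε : Sgn) (z₁ z₂ : ℂˣ) (s : ℂ) (a b i j : Fin 2)
      (hz : SpecReg η p (z₁ / z₂)) (hz' : SpecReg η (pstar η p c) (z₁ / z₂))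
      (hs : DynReg η p s) (hs' : ∀ μ ∈ W, DynReg η (pstar η p c) (s + μ)) :
      Rel η p c W
        (rllLeft η (pstar η p c) (z₁ / z₂) ε ε z₁ z₂ s a b i j)
        (rllRight η p (z₁ / z₂) ε ε z₁ z₂ s a b i j)
  /-- `R₁₂(q^c z₁/z₂, λ+h) L⁺₁(z₁, λ) L⁻₂(z₂, λ+σ_z⁽¹⁾) =
  L⁻₂(z₂, λ) L⁺₁(z₁, λ+σ_z⁽²⁾) R₁₂(q^{-c} z₁/z₂, λ)` -/
  | rll_mixed (z₁ z₂ : ℂˣ) (s : ℂ) (a b i j : Fin 2)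
      (hz : SpecReg η p (qpow η (-c) * (z₁ / z₂)))
      (hz' : SpecReg η (pstar η p c) (qpow η c * (z₁ / z₂)))
      (hs : DynReg η p s) (hs' : ∀ μ ∈ W, DynReg η (pstar η p c) (s + μ)) :
      Rel η p c W
        (rllLeft η (pstar η p c) (qpow η c * (z₁ / z₂)) Sgn.plus Sgn.minus z₁ z₂ s a b i j)
        (rllRight η p (qpow η (-c) * (z₁ / z₂)) Sgn.plus Sgn.minus z₁ z₂ s a b i j)

/-- The dynamical elliptic quantum algebra `B_{q,λ}(gl̂₂)` at central charge `c`, in its `RLL`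
presentation. -/
abbrev B (η p c : ℂ) (W : Set ℂ) : Type := RingQuot (Rel η p c W)

section Functionals

variable (η p c : ℂ) (W : Set ℂ)

/-- The Lax matrix `L^ε(z, λ) ∈ End V ⊗ B_{q,λ}(gl̂₂)`. -/
def lax (ε : Sgn) (z : ℂˣ) (s : ℂ) : Matrix (Fin 2) (Fin 2) (B η p c W) :=
  of fun i j => RingQuot.mkAlgHom ℂ (Rel η p c W) (gL ε i j z s)

/-- The inverse Lax matrix `L^ε(z, λ)⁻¹`. -/
def laxInv (ε : Sgn) (z : ℂˣ) (s : ℂ) : Matrix (Fin 2) (Fin 2) (B η p c W) :=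
  of fun i j => RingQuot.mkAlgHom ℂ (Rel η p c W) (gLinv ε i j z s)

theorem lax_mul_laxInv (ε : Sgn) (z : ℂˣ) (s : ℂ) :
    lax η p c W ε z s * laxInv η p c W ε z s = 1 := by
  ext i j
  have h := RingQuot.mkAlgHom_rel ℂ (Rel.mul_inv (η := η) (p := p) (c := c) (W := W) ε i j z s)
  rw [map_sum] at h
  simp only [map_mul] at h
  rw [Matrix.mul_apply, Matrix.one_apply]
  simp only [lax, laxInv, of_apply]
  rw [h]
  split_ifs <;> simp

theorem laxInv_mul_lax (ε : Sgn) (z : ℂˣ) (s : ℂ) :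
    laxInv η p c W ε z s * lax η p c W ε z s = 1 := by
  ext i j
  have h := RingQuot.mkAlgHom_rel ℂ (Rel.inv_mul (η := η) (p := p) (c := c) (W := W) ε i j z s)
  rw [map_sum] at h
  simp only [map_mul] at h
  rw [Matrix.mul_apply, Matrix.one_apply]
  simp only [lax, laxInv, of_apply]
  rw [h]
  split_ifs <;> simp

/-- `Υ(λ) = w ^ (-1/2) Θ_p(w)`. -/
def Ups (s : ℂ) : ℂ := qpow η (-s) * theta p (qpow η (2 * s))

/-- Difference operators in `λ` with coefficients in the algebra act on its functions of `s`. -/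
abbrev DiffOp : Type := Module.End ℂ (ℂ → B η p c W)

/-- A function of `λ` as the operator of left multiplication. -/
def mulOp (F : ℂ → B η p c W) : DiffOp η p c W := LinearMap.mulLeft ℂ F

/-- `e^{k ∂}`: the shift `s ↦ s + k`. -/
def shiftOp (k : ℂ) : DiffOp η p c W :=
  LinearMap.funLeft ℂ (B η p c W) (fun s : ℂ => s + k)

/-- The diagonal matrix `e^{k σ_z ∂}`. -/
def expMat (k : ℂ) : Matrix (Fin 2) (Fin 2) (DiffOp η p c W) :=
  diagonal fun i => shiftOp η p c W (k * sig i)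

/-- A matrix that depends on `λ`, as a matrix of multiplication operators. -/
def opMat (M : ℂ → Matrix (Fin 2) (Fin 2) (B η p c W)) :
    Matrix (Fin 2) (Fin 2) (DiffOp η p c W) :=
  of fun i j => mulOp η p c W fun s => M s i j

/-- The diagonal matrix `N(λ) = Υ(λ - σ_z) / Υ(λ)`. -/
def Nmat (s : ℂ) : Matrix (Fin 2) (Fin 2) (B η p c W) :=
  diagonal fun i => algebraMap ℂ _ (Ups η p (s - sig i) / Ups η p s)

/-- `tr (N(λ) e^{-σ_z ∂} A(λ) A'(λ) e^{σ_z ∂})`. -/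
def traceOp (A A' : ℂ → Matrix (Fin 2) (Fin 2) (B η p c W)) : DiffOp η p c W :=
  trace (opMat η p c W (Nmat η p c W) * expMat η p c W (-1) * opMat η p c W A *
    opMat η p c W A' * expMat η p c W 1)

/-- The difference operator `traceOp` is the multiplication by a function of `λ`. -/
theorem traceOp_eq (A A' : ℂ → Matrix (Fin 2) (Fin 2) (B η p c W)) :
    traceOp η p c W A A' = mulOp η p c W fun s =>
      ∑ i, algebraMap ℂ _ (Ups η p (s - sig i) / Ups η p s) *
        (A (s - sig i) * A' (s - sig i)) i i := by
  refine LinearMap.ext fun f => funext fun s => ?_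
  simp [traceOp, opMat, expMat, Nmat, mulOp, shiftOp, trace, Matrix.mul_apply, Fin.sum_univ_two,
    diagonal, LinearMap.funLeft_apply, sub_eq_add_neg, Pi.mul_apply]
  noncomm_ring

/-- `t(z, λ) = tr (N(λ) e^{-σ_z ∂} L⁺(q^{-c} z, λ)⁻¹ L⁻(z, λ) e^{σ_z ∂})`, read off from the
multiplication operator by applying it to the constant function `1`. -/
def t (z : ℂˣ) (s : ℂ) : B η p c W :=
  traceOp η p c W (laxInv η p c W Sgn.plus (qpow η (-c) * z)) (lax η p c W Sgn.minus z) 1 s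

/-- `t*(z, λ) = tr (N(λ) e^{-σ_z ∂} L⁻(q^c z, λ)⁻¹ L⁺(z, λ) e^{σ_z ∂})`. -/
def tstar (z : ℂˣ) (s : ℂ) : B η p c W :=
  traceOp η p c W (laxInv η p c W Sgn.minus (qpow η c * z)) (lax η p c W Sgn.plus z) 1 s

end Functionals

end EllipticB

end

noncomputable section

namespace EllipticB

open Filter Topology

/-! ### Infinite products -/

/-! Fix $M=L^\pm(z_2)$, and let $X=L^{-1}L'$ be the product under the trace. Both $L$ and $L'$
satisfy an exchange relation with $M$. The shift $q^{\mp c}$ of the spectral parameter in $L$ is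
chosen so that the left factors $R(x,\lambda+h)$ of the two relations coincide. This factor, the
only one with entries in the algebra, therefore cancels (`Exchange.inv_mul`). What remains is
$X_1M_2(\lambda+\sigma_z^{(1)})=M_2(\lambda+\sigma_z^{(1)})\,R(q^4u,\lambda)^{-1}X_1(\lambda+\sigma_z^{(2)})\,R(u,\lambda)$.
The offset $q^4$ between the two scalar $R$-matrices is what $c=\mp2$ produces.

By unitarity (`Rmat_unitarity`), $R(q^4u)^{-1}$ is $R_{21}((q^4u)^{-1})$ up to a scalar. Weight
conservation makes the argument of $X$ independent of the indices summed in the trace. The trace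
weighted by $N$ then contracts the two $R$-matrices to the identity: this is the crossing symmetry
`Rmat_crossing`, and `trace_mul_of_exchange` draws the conclusion.

Entry by entry, unitarity and crossing reduce to the inversion `theta_inv`, the three-term identity
`theta_three_term` and the functional equation `rho_mul_theta`. The three-term identity comes from
the Jacobi triple product, which gives $\Theta(xy)\Theta(x/y)$ as a $2\times2$ determinant.

The relation of $L^-$ with $L^+$ in this order is the mixed relation inverted. Inverting it produces
the scalar $\rho\rho^{-}$, where $\rho^-(z)=\rho(z^{-1})$, at $q^{c}x$ on one side and at $q^{-c}x$
on the other. The two values agree because this scalar does not depend on the nome and is invariant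
under $z\mapsto q^4z$ (`rho_mul_rho_inv`, `rhoNorm_qpow_four_mul`). -/

theorem summable_norm_poch {p : ℂ} (hp : ‖p‖ < 1) (z : ℂ) :
    Summable fun n : ℕ => ‖-(z * p ^ n)‖ := by
  simp only [norm_neg, norm_mul, norm_pow]
  exact (summable_geometric_of_lt_one (norm_nonneg _) hp).mul_left _

theorem multipliable_poch {p : ℂ} (hp : ‖p‖ < 1) (z : ℂ) :
    Multipliable fun n : ℕ => 1 - z * p ^ n := by
  simpa only [← sub_eq_add_neg] using multipliable_one_add_of_summable (summable_norm_poch hp z)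

theorem poch_eq_mul {p : ℂ} (hp : ‖p‖ < 1) (z : ℂ) :
    poch z p = (1 - z) * poch (z * p) p := by
  have hc : (fun n : ℕ => 1 - z * p ^ (n + 1)) = fun n : ℕ => 1 - z * p * p ^ n :=
    funext fun n => by rw [pow_succ', mul_assoc]
  have h := tprod_eq_zero_mul' (f := fun n : ℕ => 1 - z * p ^ n)
    (by rw [hc]; exact multipliable_poch hp (z * p))
  rw [hc, pow_zero, mul_one] at h
  exact h

theorem poch_ne_zero {p : ℂ} (hp : ‖p‖ < 1) {z : ℂ} (hz : ∀ n : ℕ, z * p ^ n ≠ 1) :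
    poch z p ≠ 0 := by
  have := tprod_one_add_ne_zero_of_summable (f := fun n : ℕ => -(z * p ^ n))
    (fun n h => hz n (by linear_combination -h)) (summable_norm_poch hp z)
  simpa only [← sub_eq_add_neg, poch] using this

theorem poch_self_ne_zero {p : ℂ} (hp : ‖p‖ < 1) : poch p p ≠ 0 := by
  refine poch_ne_zero hp fun n h => ?_
  rw [← pow_succ'] at h
  have := congrArg norm h
  rw [norm_pow, norm_one] at this
  exact absurd this (pow_lt_one₀ (norm_nonneg _) hp (by simp)).ne

/-! ### Inversion and zeros of the theta function -/

/-- Once the factor $1-x$, respectively $1-x^{-1}$, is split off, the remaining product is invariant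
under $x\mapsto x^{-1}$. -/
theorem theta_inv {p : ℂ} (hp : ‖p‖ < 1) {x : ℂ} (hx : x ≠ 0) :
    theta p x⁻¹ = -x⁻¹ * theta p x := by
  rw [theta, theta, poch_eq_mul hp x, poch_eq_mul hp x⁻¹, div_inv_eq_mul, div_eq_mul_inv,
    mul_comm p x, mul_comm p x⁻¹]
  field_simp
  ring

theorem theta_ne_zero {p : ℂ} (hp₀ : p ≠ 0) (hp : ‖p‖ < 1) {x : ℂ} (hx₀ : x ≠ 0)
    (hx : ∀ n : ℤ, x ≠ p ^ n) : theta p x ≠ 0 := by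
  refine mul_ne_zero (mul_ne_zero (poch_ne_zero hp fun n h => hx (-n) ?_)
    (poch_ne_zero hp fun n h => hx (n + 1) ?_)) (poch_self_ne_zero hp)
  · rw [_root_.zpow_neg, zpow_natCast]; exact eq_inv_of_mul_eq_one_left h
  · field_simp at h
    rw [zpow_add_one₀ hp₀, zpow_natCast, mul_comm]; exact h.symm

/-! ### The Jacobi triple product -/

/-- The Gaussian binomial coefficients with parameter `p`. -/
def gaussBinom (p : ℂ) : ℕ → ℕ → ℂ
  | _, 0 => 1
  | 0, _ + 1 => 0
  | n + 1, k + 1 => p ^ (k + 1) * gaussBinom p n (k + 1) + gaussBinom p n k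

/-- The finite product `(p; p)_n`. -/
def qfac (p : ℂ) (n : ℕ) : ℂ := ∏ i ∈ Finset.range n, (1 - p * p ^ i)

theorem gaussBinom_zero_right (p : ℂ) (n : ℕ) : gaussBinom p n 0 = 1 := by
  cases n <;> rfl

theorem gaussBinom_eq_zero (p : ℂ) : ∀ {n k : ℕ}, n < k → gaussBinom p n k = 0
  | 0, _ + 1, _ => rfl
  | n + 1, k + 1, h => by
    rw [gaussBinom, gaussBinom_eq_zero p (show n < k + 1 by omega),
      gaussBinom_eq_zero p (show n < k by omega)]
    simp

/-- The $q$-binomial theorem. Splitting off $1+x$ leaves the shorter product at $xp$, and comparison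
of coefficients is the Pascal rule defining `gaussBinom`. -/
theorem prod_one_add_mul_pow (p x : ℂ) (n : ℕ) :
    ∏ k ∈ Finset.range n, (1 + x * p ^ k) =
      ∑ k ∈ Finset.range (n + 1), p ^ k.choose 2 * gaussBinom p n k * x ^ k := by
  induction n generalizing x with
  | zero => simp [gaussBinom]
  | succ n ih =>
    have h : ∏ k ∈ Finset.range n, (1 + x * p ^ (k + 1)) =
        ∏ k ∈ Finset.range n, (1 + x * p * p ^ k) :=
      Finset.prod_congr rfl fun k _ => by ring
    have h1 : ∑ k ∈ Finset.range (n + 1), p ^ k.choose 2 * gaussBinom p n k * (x * p) ^ k =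
        1 + ∑ k ∈ Finset.range (n + 1),
          p ^ (k + 1).choose 2 * gaussBinom p n (k + 1) * (x * p) ^ (k + 1) := by
      rw [Finset.sum_range_succ', Finset.sum_range_succ, gaussBinom_eq_zero p (Nat.lt_succ_self n)]
      simp [gaussBinom_zero_right, add_comm]
    rw [Finset.prod_range_succ', h, ih, pow_zero, mul_one, Finset.sum_range_succ' _ (n + 1),
      mul_add, mul_one]
    nth_rewrite 1 [h1]
    rw [Finset.sum_mul, add_assoc, add_comm, ← Finset.sum_add_distrib]
    simp only [gaussBinom_zero_right, Nat.choose_zero_succ, pow_zero, mul_one]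
    rw [add_left_inj]
    refine Finset.sum_congr rfl fun k _ => ?_
    rw [gaussBinom, Nat.choose_succ_succ', Nat.choose_one_right]
    ring

theorem qfac_succ (p : ℂ) (n : ℕ) : qfac p (n + 1) = qfac p n * (1 - p ^ (n + 1)) := by
  rw [qfac, Finset.prod_range_succ, ← pow_succ', qfac]

/-- The quotient formula for Gaussian binomials, kept free of division so that it holds for every
$p$. -/
theorem gaussBinom_mul_qfac (p : ℂ) (a b : ℕ) :
    gaussBinom p (a + b) a * qfac p a * qfac p b = qfac p (a + b) := by
  induction h : a + b generalizing a b with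
  | zero =>
    obtain ⟨rfl, rfl⟩ : a = 0 ∧ b = 0 := by omega
    simp [gaussBinom, qfac]
  | succ n ih =>
    rcases a with _ | a
    · obtain rfl : b = n + 1 := by omega
      simp [gaussBinom, qfac]
    have h2 := ih a b (by omega)
    rw [gaussBinom, qfac_succ p n]
    rcases b with _ | b
    · obtain rfl : a = n := by omega
      rw [gaussBinom_eq_zero p (Nat.lt_succ_self a), qfac_succ]
      linear_combination (1 - p ^ (a + 1)) * h2
    · have h1 := ih (a + 1) b (by omega)
      obtain rfl : n = a + b + 1 := by omega
      rw [qfac_succ p a] at h1 ⊢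
      rw [qfac_succ p b] at h2 ⊢
      linear_combination p ^ (a + 1) * (1 - p ^ (b + 1)) * h1 + (1 - p ^ (a + 1)) * h2

/-- With $p=e^{2\pi i\tau}$ and $zp^{-1/2}=e^{2\pi iv}$ the terms are those of the Jacobi theta
series, and $|p|<1$ means $\operatorname{Im}\tau>0$. -/
theorem summable_zpow_mul_zpow {p : ℂ} (hp₀ : p ≠ 0) (hp : ‖p‖ < 1) {z : ℂ} (hz : z ≠ 0) :
    Summable fun n : ℤ => p ^ (n * (n - 1) / 2) * z ^ n := by
  have hπ : (Real.pi : ℂ) ≠ 0 := by exact_mod_cast Real.pi_ne_zero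
  have hI := Complex.I_ne_zero
  set τ : ℂ := Complex.log p / (2 * Real.pi * Complex.I) with hτ
  set v : ℂ := (Complex.log z - Complex.log p / 2) / (2 * Real.pi * Complex.I) with hv
  have him : 0 < τ.im := by
    have : τ = -(Complex.I * Complex.log p) / ((2 * Real.pi : ℝ) : ℂ) := by
      rw [hτ]; push_cast; field_simp; simp
    rw [this, Complex.div_ofReal_im]
    refine div_pos ?_ (by positivity)
    simpa [Complex.log_re] using Real.log_neg (norm_pos_iff.2 hp₀) hp
  refine ((summable_jacobiTheta₂_term_iff v τ).2 him).congr fun n => ?_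
  obtain ⟨m, hm⟩ : ∃ m, n * (n - 1) = m + m := Int.even_mul_pred_self n
  have h2 : n * (n - 1) / 2 = m := by omega
  have h3 : (n : ℂ) * (n - 1) = m + m := by exact_mod_cast hm
  rw [h2, jacobiTheta₂_term]
  have hpm : p ^ m = Complex.exp (m * Complex.log p) := by
    rw [Complex.exp_int_mul, Complex.exp_log hp₀]
  have hzn : z ^ n = Complex.exp (n * Complex.log z) := by
    rw [Complex.exp_int_mul, Complex.exp_log hz]
  rw [hpm, hzn, ← Complex.exp_add]
  congr 1
  rw [hτ, hv]
  field_simp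
  linear_combination Complex.log p * h3

/-- The `n`-th term of the Laurent expansion of `Θ_p(z)`. -/
def thetaTerm (p z : ℂ) (n : ℤ) : ℂ := p ^ (n * (n - 1) / 2) * (-z) ^ n

theorem choose_two_cast (k : ℕ) : (k.choose 2 : ℤ) = (k : ℤ) * (k - 1) / 2 := by
  rw [Nat.choose_two_right]
  rcases k with _ | k
  · simp
  · push_cast; simp

theorem prod_neg_mul_zpow {p : ℂ} (hp₀ : p ≠ 0) (z : ℂ) (n : ℕ) :
    ∏ k ∈ Finset.range n, (-z * p ^ (-(k + 1) : ℤ)) =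
      (-z) ^ (n : ℤ) * p ^ (-((n : ℤ) * (n + 1) / 2)) := by
  rw [Finset.prod_mul_distrib, Finset.prod_const, Finset.card_range, zpow_natCast]
  congr 1
  induction n with
  | zero => simp
  | succ n ih =>
    rw [Finset.prod_range_succ, ih, ← zpow_add₀ hp₀]
    congr 1
    have : ((n + 1 : ℕ) : ℤ) * ((n + 1 : ℕ) + 1) = n * (n + 1) + 2 * (n + 1) := by push_cast; ring
    omega

theorem finite_triple_product {p z : ℂ} (hp₀ : p ≠ 0) (hz : z ≠ 0) (n : ℕ) :
    (∏ k ∈ Finset.range n, (1 - z * p ^ k)) * ∏ k ∈ Finset.range n, (1 - p / z * p ^ k) =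
      ∑ k ∈ Finset.range (2 * n + 1),
        gaussBinom p (2 * n) k * thetaTerm p z ((k : ℤ) - n) := by
  -- The argument $-zp^{-n}$ centres the product. The last $n$ of the $2n$ factors are $1-zp^k$; the
  -- first $n$, in reverse order, are $1-zp^{-(k+1)}=-zp^{-(k+1)}(1-p^{k+1}/z)$.
  have key := prod_one_add_mul_pow p (-z * p ^ (-n : ℤ)) (2 * n)
  have hsplit : ∏ k ∈ Finset.range (2 * n), (1 + -z * p ^ (-n : ℤ) * p ^ k) =
      (∏ k ∈ Finset.range n, (-z * p ^ (-(k + 1) : ℤ))) *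
        ((∏ k ∈ Finset.range n, (1 - z * p ^ k)) *
          ∏ k ∈ Finset.range n, (1 - p / z * p ^ k)) := by
    rw [two_mul, Finset.prod_range_add,
      ← Finset.prod_range_reflect (fun k => 1 + -z * p ^ (-n : ℤ) * p ^ k),
      mul_comm (∏ k ∈ Finset.range n, (1 - z * p ^ k)), ← mul_assoc,
      ← Finset.prod_mul_distrib (f := fun k : ℕ => -z * p ^ (-(k + 1) : ℤ))]
    refine congrArg₂ (· * ·) (Finset.prod_congr rfl fun k hk => ?_)
      (Finset.prod_congr rfl fun k _ => ?_)
    · have hk := Finset.mem_range.1 hk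
      have : ((n - 1 - k : ℕ) : ℤ) = n - (k + 1) := by omega
      rw [← zpow_natCast p (n - 1 - k), this, mul_assoc, ← zpow_add₀ hp₀,
        show (-n : ℤ) + (n - (k + 1)) = -(k + 1) by ring, _root_.zpow_neg, zpow_add_one₀ hp₀,
        zpow_natCast]
      field_simp
      ring
    · rw [pow_add, _root_.zpow_neg, zpow_natCast]
      field_simp
      ring
  have hz' : -z ≠ 0 := neg_ne_zero.2 hz
  rw [hsplit, prod_neg_mul_zpow hp₀] at key
  refine mul_left_cancel₀ (mul_ne_zero (zpow_ne_zero _ hz') (zpow_ne_zero _ hp₀)) (key.trans ?_)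
  rw [Finset.mul_sum]
  refine Finset.sum_congr rfl fun k _ => ?_
  obtain ⟨a, ha⟩ := Int.even_mul_pred_self (k : ℤ)
  obtain ⟨b, hb⟩ := Int.even_mul_succ_self (n : ℤ)
  have h3 : ((k : ℤ) - n) * (k - n - 1) = 2 * (a + b - n * k) := by linear_combination ha + hb
  rw [thetaTerm, h3, hb, ← zpow_natCast p (k.choose 2), choose_two_cast, ha, ← two_mul, ← two_mul,
    Int.mul_ediv_cancel_left _ two_ne_zero, Int.mul_ediv_cancel_left _ two_ne_zero,
    Int.mul_ediv_cancel_left _ two_ne_zero, mul_pow, ← zpow_natCast (-z) k,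
    ← zpow_natCast (p ^ (-n : ℤ)), ← _root_.zpow_mul, zpow_sub₀ hz', zpow_sub₀ hp₀, zpow_add₀ hp₀,
    neg_mul, _root_.zpow_neg, _root_.zpow_neg]
  field_simp

theorem tendsto_qfac {p : ℂ} (hp : ‖p‖ < 1) : Tendsto (qfac p) atTop (𝓝 (poch p p)) :=
  (multipliable_poch hp p).tendsto_prod_tprod_nat

theorem qfac_ne_zero {p : ℂ} (hp : ‖p‖ < 1) (n : ℕ) : qfac p n ≠ 0 := by
  refine Finset.prod_ne_zero_iff.2 fun i _ h => ?_
  have := congrArg norm (sub_eq_zero.1 h).symm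
  rw [← pow_succ', norm_pow, norm_one] at this
  exact absurd this (pow_lt_one₀ (norm_nonneg _) hp (by simp)).ne

/-- The coefficients of the finite triple product, indexed by the integers. -/
def tripleCoeff (p : ℂ) (n : ℕ) (j : ℤ) : ℂ :=
  if 0 ≤ j + n then gaussBinom p (2 * n) (j + n).toNat else 0

theorem tripleCoeff_eq {p : ℂ} (hp : ‖p‖ < 1) {n : ℕ} {j : ℤ} (hj : 0 ≤ j + n)
    (hj' : 0 ≤ n - j) :
    tripleCoeff p n j = qfac p (2 * n) * (qfac p (j + n).toNat)⁻¹ * (qfac p (n - j).toNat)⁻¹ := by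
  have h := gaussBinom_mul_qfac p (j + n).toNat (n - j).toNat
  rw [show (j + n).toNat + (n - j).toNat = 2 * n by omega] at h
  rw [tripleCoeff, if_pos hj, ← h]
  field_simp [qfac_ne_zero hp]

/-- Supplies the dominating constant for the limit in `theta_eq_tsum`: the convergent sequences
$(p;p)_n$ and $1/(p;p)_n$ are bounded. -/
theorem exists_norm_tripleCoeff_le {p : ℂ} (hp : ‖p‖ < 1) :
    ∃ C, ∀ n j, ‖tripleCoeff p n j‖ ≤ C := by
  obtain ⟨A, hA⟩ := (Metric.isBounded_range_of_tendsto _ (tendsto_qfac hp)).exists_norm_le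
  obtain ⟨D, hD⟩ := (Metric.isBounded_range_of_tendsto _
    ((tendsto_qfac hp).inv₀ (poch_self_ne_zero hp))).exists_norm_le
  have hA' := fun n => hA _ (Set.mem_range_self n)
  have hD' := fun n => hD _ (Set.mem_range_self n)
  have hA0 := (norm_nonneg _).trans (hA' 0)
  have hD0 := (norm_nonneg _).trans (hD' 0)
  refine ⟨A * D * D, fun n j => ?_⟩
  have h0 : 0 ≤ A * D * D := by positivity
  by_cases hj : 0 ≤ j + n
  · by_cases hj' : 0 ≤ n - j
    · rw [tripleCoeff_eq hp hj hj', norm_mul, norm_mul]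
      gcongr
      exacts [hA' _, hD' _, hD' _]
    · rw [tripleCoeff, if_pos hj, gaussBinom_eq_zero p (by omega), norm_zero]
      exact h0
  · rw [tripleCoeff, if_neg hj, norm_zero]
    exact h0

theorem tendsto_tripleCoeff {p : ℂ} (hp : ‖p‖ < 1) (j : ℤ) :
    Tendsto (fun n => tripleCoeff p n j) atTop (𝓝 (poch p p)⁻¹) := by
  have h0 := poch_self_ne_zero hp
  have hq := tendsto_qfac hp
  have h1 : Tendsto (fun n : ℕ => 2 * n) atTop atTop :=
    tendsto_atTop_atTop.2 fun b => ⟨b, fun a ha => by omega⟩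
  have h2 : Tendsto (fun n : ℕ => (j + n).toNat) atTop atTop := by
    refine tendsto_atTop_atTop.2 fun b => ⟨b + j.natAbs, fun a ha => by omega⟩
  have h3 : Tendsto (fun n : ℕ => ((n : ℤ) - j).toNat) atTop atTop := by
    refine tendsto_atTop_atTop.2 fun b => ⟨b + j.natAbs, fun a ha => by omega⟩
  have h := ((hq.comp h1).mul ((hq.comp h2).inv₀ h0)).mul ((hq.comp h3).inv₀ h0)
  rw [mul_inv_cancel₀ h0, one_mul] at h
  refine h.congr' ?_
  filter_upwards [eventually_ge_atTop j.natAbs] with n hn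
  rw [tripleCoeff_eq hp (by omega) (by omega)]
  rfl

/-- The Jacobi triple product identity. -/
theorem theta_eq_tsum {p : ℂ} (hp₀ : p ≠ 0) (hp : ‖p‖ < 1) {z : ℂ} (hz : z ≠ 0) :
    theta p z = ∑' n : ℤ, thetaTerm p z n := by
  obtain ⟨C, hC⟩ := exists_norm_tripleCoeff_le hp
  have hs : Summable (thetaTerm p z) := summable_zpow_mul_zpow hp₀ hp (neg_ne_zero.2 hz)
  -- Termwise limit of the finite triple product: every coefficient tends to $1/(p;p)_\infty$, which
  -- is the third factor of $\Theta_p$ moved across.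
  have h1 := tendsto_tsum_of_dominated_convergence
    (f := fun n j => tripleCoeff p n j * thetaTerm p z j)
    (hs.norm.mul_left C) (fun j => (tendsto_tripleCoeff hp j).mul_const (thetaTerm p z j))
    (Eventually.of_forall fun n j => by
      rw [norm_mul]; exact mul_le_mul_of_nonneg_right (hC n j) (norm_nonneg _))
  have h2 := (multipliable_poch hp z).tendsto_prod_tprod_nat.mul
    (multipliable_poch hp (p / z)).tendsto_prod_tprod_nat
  have h3 := tendsto_nhds_unique (h2.congr fun n => ?_) h1
  · rw [tsum_mul_left] at h3
    rw [theta, poch, poch, h3]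
    field_simp [poch_self_ne_zero hp]
  · rw [finite_triple_product hp₀ hz]
    have hinj : Function.Injective fun k : ℕ => (k : ℤ) - n := fun a b h => by
      simpa using h
    -- The coefficient vanishes for $|j|>n$, so the sum over $\mathbb Z$ is the finite one with
    -- $j=k-n$.
    rw [tsum_eq_sum (s := (Finset.range (2 * n + 1)).map ⟨_, hinj⟩), Finset.sum_map]
    · simp [tripleCoeff]
    · intro j hj
      rw [tripleCoeff]
      split_ifs with h
      · rw [gaussBinom_eq_zero, zero_mul]
        by_contra hlt
        refine hj (Finset.mem_map.2 ⟨(j + n).toNat, by simp; omega, by simp; omega⟩)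
      · rw [zero_mul]

/-! ### The three-term identity -/

/-- The even part of the bilinear expansion of the theta function. -/
def thetaEven (p x : ℂ) : ℂ := ∑' a : ℤ, p ^ (a * a) * x ^ (2 * a)

/-- The odd part of the bilinear expansion of the theta function. -/
def thetaOdd (p x : ℂ) : ℂ := ∑' a : ℤ, p ^ (a * a + a) * x ^ (2 * a + 1)

theorem summable_thetaEven {p : ℂ} (hp₀ : p ≠ 0) (hp : ‖p‖ < 1) {x : ℂ} (hx : x ≠ 0) :
    Summable fun a : ℤ => p ^ (a * a) * x ^ (2 * a) := by
  refine (summable_zpow_mul_zpow (p := p ^ 2) (z := p * x ^ 2) (pow_ne_zero _ hp₀) ?_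
    (mul_ne_zero hp₀ (pow_ne_zero _ hx))).congr fun a => ?_
  · rw [norm_pow]; exact pow_lt_one₀ (norm_nonneg _) hp two_ne_zero
  · obtain ⟨m, hm⟩ := Int.even_mul_pred_self a
    rw [hm, ← two_mul, Int.mul_ediv_cancel_left _ two_ne_zero, mul_zpow, ← zpow_natCast p 2,
      ← zpow_natCast x 2, ← _root_.zpow_mul, ← _root_.zpow_mul, ← mul_assoc, ← zpow_add₀ hp₀,
      show ((2 : ℕ) : ℤ) * m + a = a * a by push_cast; linear_combination -hm]
    simp

theorem summable_thetaOdd {p : ℂ} (hp₀ : p ≠ 0) (hp : ‖p‖ < 1) {x : ℂ} (hx : x ≠ 0) :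
    Summable fun a : ℤ => p ^ (a * a + a) * x ^ (2 * a + 1) := by
  refine (((summable_zpow_mul_zpow (p := p ^ 2) (z := p ^ 2 * x ^ 2) (pow_ne_zero _ hp₀) ?_
    (mul_ne_zero (pow_ne_zero _ hp₀) (pow_ne_zero _ hx)))).mul_left x).congr fun a => ?_
  · rw [norm_pow]; exact pow_lt_one₀ (norm_nonneg _) hp two_ne_zero
  · obtain ⟨m, hm⟩ := Int.even_mul_pred_self a
    rw [hm, ← two_mul, Int.mul_ediv_cancel_left _ two_ne_zero, mul_zpow, ← zpow_natCast p 2,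
      ← zpow_natCast x 2, ← _root_.zpow_mul, ← _root_.zpow_mul, ← _root_.zpow_mul, ← mul_assoc (p ^ _),
      ← zpow_add₀ hp₀, zpow_add_one₀ hx,
      show ((2 : ℕ) : ℤ) * m + (2 : ℕ) * a = a * a + a by push_cast; linear_combination -hm]
    push_cast
    ring

/-- Pairs of integers according to the parity of their sum. -/
def pairParityEquiv : (ℤ × ℤ) ⊕ (ℤ × ℤ) ≃ ℤ × ℤ where
  toFun := Sum.elim (fun x => (x.1 + x.2, x.1 - x.2)) (fun x => (x.1 + x.2 + 1, x.1 - x.2))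
  invFun x := if (x.1 + x.2) % 2 = 0 then Sum.inl ((x.1 + x.2) / 2, (x.1 - x.2) / 2)
    else Sum.inr ((x.1 + x.2 - 1) / 2, (x.1 - x.2 - 1) / 2)
  left_inv := by
    rintro (⟨a, b⟩ | ⟨a, b⟩)
    · have h : (a + b + (a - b)) % 2 = 0 := by omega
      simp only [Sum.elim_inl, h, if_true]
      congr 2 <;> omega
    · have h : ¬(a + b + 1 + (a - b)) % 2 = 0 := by omega
      simp only [Sum.elim_inr, h, if_false]
      congr 2 <;> omega
  right_inv := by
    rintro ⟨m, n⟩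
    dsimp only
    split_ifs with h
    · simp only [Sum.elim_inl]
      congr 1 <;> omega
    · simp only [Sum.elim_inr]
      congr 1 <;> omega

theorem thetaTerm_mul_even {p : ℂ} (hp₀ : p ≠ 0) {x y : ℂ} (hx : x ≠ 0) (hy : y ≠ 0) (a b : ℤ) :
    thetaTerm p (x * y) (a + b) * thetaTerm p (x / y) (a - b) =
      (p ^ (a * a - a) * x ^ (2 * a)) * (p ^ (b * b) * y ^ (2 * b)) := by
  obtain ⟨m, hm⟩ := Int.even_mul_pred_self (a + b)
  obtain ⟨n, hn⟩ := Int.even_mul_pred_self (a - b)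
  have hmn : m + n = (a * a - a) + b * b := by
    refine mul_left_cancel₀ (two_ne_zero (α := ℤ)) ?_
    linear_combination -(hm + hn)
  have hsg : ((-1 : ℂ) ^ (a + b)) * (-1) ^ (a - b) = 1 := by
    rw [← zpow_add₀ (by norm_num), show a + b + (a - b) = 2 * a by ring]
    exact (even_two_mul a).neg_one_zpow
  rw [thetaTerm, thetaTerm, hm, hn, ← two_mul, ← two_mul, Int.mul_ediv_cancel_left _ two_ne_zero,
    Int.mul_ediv_cancel_left _ two_ne_zero]
  calc _ = ((-1) ^ (a + b) * (-1) ^ (a - b)) * (p ^ m * p ^ n) * (x ^ (a + b) * x ^ (a - b)) *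
        (y ^ (a + b) * (y ^ (a - b))⁻¹) := by
        rw [neg_eq_neg_one_mul (x * y), neg_eq_neg_one_mul (x / y), mul_zpow, mul_zpow, mul_zpow,
          div_zpow]
        ring
    _ = _ := by
        rw [hsg, ← zpow_add₀ hp₀, ← zpow_add₀ hx, ← _root_.zpow_neg, ← zpow_add₀ hy, hmn,
          zpow_add₀ hp₀]
        ring_nf

theorem thetaTerm_mul_odd {p : ℂ} (hp₀ : p ≠ 0) {x y : ℂ} (hx : x ≠ 0) (hy : y ≠ 0) (a b : ℤ) :
    thetaTerm p (x * y) (a + b + 1) * thetaTerm p (x / y) (a - b) =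
      -((p ^ (a * a) * x ^ (2 * a + 1)) * (p ^ (b * b + b) * y ^ (2 * b + 1))) := by
  obtain ⟨m, hm⟩ := Int.even_mul_pred_self (a + b + 1)
  obtain ⟨n, hn⟩ := Int.even_mul_pred_self (a - b)
  have hmn : m + n = a * a + (b * b + b) := by
    refine mul_left_cancel₀ (two_ne_zero (α := ℤ)) ?_
    linear_combination -(hm + hn)
  have hsg : ((-1 : ℂ) ^ (a + b + 1)) * (-1) ^ (a - b) = -1 := by
    rw [← zpow_add₀ (by norm_num), show a + b + 1 + (a - b) = 2 * a + 1 by ring]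
    exact (odd_two_mul_add_one a).neg_one_zpow
  rw [thetaTerm, thetaTerm, hm, hn, ← two_mul, ← two_mul, Int.mul_ediv_cancel_left _ two_ne_zero,
    Int.mul_ediv_cancel_left _ two_ne_zero]
  calc _ = ((-1) ^ (a + b + 1) * (-1) ^ (a - b)) * (p ^ m * p ^ n) *
        (x ^ (a + b + 1) * x ^ (a - b)) * (y ^ (a + b + 1) * (y ^ (a - b))⁻¹) := by
        rw [neg_eq_neg_one_mul (x * y), neg_eq_neg_one_mul (x / y), mul_zpow, mul_zpow, mul_zpow,
          div_zpow]
        ring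
    _ = _ := by
        rw [hsg, ← zpow_add₀ hp₀, ← zpow_add₀ hx, ← _root_.zpow_neg, ← zpow_add₀ hy, hmn,
          zpow_add₀ hp₀]
        ring_nf

/-- In the double Laurent series, pairs $(m,n)$ of equal parity are written $(a+b,a-b)$ and the
others $(a+b+1,a-b)$; this separates $x$ from $y$. The determinant form makes the three-term
identity purely algebraic. -/
theorem theta_mul_theta {p : ℂ} (hp₀ : p ≠ 0) (hp : ‖p‖ < 1) {x y : ℂ} (hx : x ≠ 0)
    (hy : y ≠ 0) :
    theta p (x * y) * theta p (x / y) =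
      x * (thetaOdd p x * thetaEven p y - thetaEven p x * thetaOdd p y) := by
  have hxy : Summable (thetaTerm p (x * y)) :=
    summable_zpow_mul_zpow hp₀ hp (neg_ne_zero.2 (mul_ne_zero hx hy))
  have hxy' : Summable (thetaTerm p (x / y)) :=
    summable_zpow_mul_zpow hp₀ hp (neg_ne_zero.2 (div_ne_zero hx hy))
  -- The prefactor $x$ is absorbed into the odd series by the shift $a\mapsto a+1$.
  have hshift : ∀ a : ℤ, x * (p ^ (a * a + a) * x ^ (2 * a + 1)) =
      p ^ ((a + 1) * (a + 1) - (a + 1)) * x ^ (2 * (a + 1)) := fun a => by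
    rw [show (a + 1) * (a + 1) - (a + 1) = a * a + a by ring,
      show 2 * (a + 1) = 2 * a + 1 + 1 by ring, zpow_add_one₀ hx (2 * a + 1)]
    ring
  have hodd := (summable_thetaOdd hp₀ hp hx).mul_left x
  simp only [hshift] at hodd
  have hodd' : Summable fun a : ℤ => p ^ (a * a - a) * x ^ (2 * a) :=
    (Equiv.addRight (1 : ℤ)).summable_iff.1 hodd
  have hev : Summable fun a : ℤ => p ^ (a * a) * x ^ (2 * a + 1) :=
    ((summable_thetaEven hp₀ hp hx).mul_left x).congr fun a => by rw [zpow_add_one₀ hx]; ring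
  have e1 : x * thetaOdd p x = ∑' a : ℤ, p ^ (a * a - a) * x ^ (2 * a) := by
    rw [thetaOdd, ← tsum_mul_left]
    simp only [hshift]
    exact (Equiv.addRight (1 : ℤ)).tsum_eq fun a : ℤ => p ^ (a * a - a) * x ^ (2 * a)
  have e2 : x * thetaEven p x = ∑' a : ℤ, p ^ (a * a) * x ^ (2 * a + 1) := by
    rw [thetaEven, ← tsum_mul_left]
    exact tsum_congr fun a => by rw [zpow_add_one₀ hx]; ring
  rw [mul_sub, ← mul_assoc, ← mul_assoc, e1, e2, theta_eq_tsum hp₀ hp (mul_ne_zero hx hy),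
    theta_eq_tsum hp₀ hp (div_ne_zero hx hy), tsum_mul_tsum_of_summable_norm hxy.norm hxy'.norm,
    thetaEven, thetaOdd,
    tsum_mul_tsum_of_summable_norm hodd'.norm (summable_thetaEven hp₀ hp hy).norm,
    tsum_mul_tsum_of_summable_norm hev.norm (summable_thetaOdd hp₀ hp hy).norm,
    ← pairParityEquiv.tsum_eq, Summable.tsum_sum]
  · simp only [pairParityEquiv, Equiv.coe_fn_mk, Sum.elim_inl, Sum.elim_inr,
      thetaTerm_mul_even hp₀ hx hy, thetaTerm_mul_odd hp₀ hx hy, tsum_neg]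
    rw [sub_eq_add_neg]
  · exact (summable_mul_of_summable_norm hxy.norm hxy'.norm).comp_injective
      (pairParityEquiv.injective.comp Sum.inl_injective)
  · exact (summable_mul_of_summable_norm hxy.norm hxy'.norm).comp_injective
      (pairParityEquiv.injective.comp Sum.inr_injective)

/-- The three-term identity of the theta function. -/
theorem theta_three_term {p : ℂ} (hp₀ : p ≠ 0) (hp : ‖p‖ < 1) {x y u : ℂ} (hx : x ≠ 0)
    (hy : y ≠ 0) (hu : u ≠ 0) :
    theta p (x * y) * theta p (x / y) * theta p u ^ 2 -
      theta p x ^ 2 * (theta p (u * y) * theta p (u / y)) =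
      u / y * theta p y ^ 2 * (theta p (x * u) * theta p (x / u)) := by
  -- The case $y=1$ turns the squares into determinants too. Up to monomials, the claim is then the
  -- Plücker relation for the four vectors (`thetaOdd`, `thetaEven`) at $x,y,u,1$.
  have h : ∀ {v : ℂ}, v ≠ 0 → theta p v ^ 2 =
      v * (thetaOdd p v * thetaEven p 1 - thetaEven p v * thetaOdd p 1) := fun {v} hv => by
    rw [← theta_mul_theta hp₀ hp hv one_ne_zero, mul_one, div_one, sq]
  rw [h hx, h hy, h hu, theta_mul_theta hp₀ hp hx hy, theta_mul_theta hp₀ hp hu hy,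
    theta_mul_theta hp₀ hp hx hu]
  field_simp
  ring

/-! ### Double infinite products -/

theorem summable_norm_poch₂ {p r : ℂ} (hp : ‖p‖ < 1) (hr : ‖r‖ < 1) (z : ℂ) :
    Summable fun n : ℕ × ℕ => ‖-(z * p ^ n.1 * r ^ n.2)‖ := by
  have h := ((summable_geometric_of_lt_one (norm_nonneg _) hp).mul_of_nonneg
    (summable_geometric_of_lt_one (norm_nonneg _) hr) (fun _ => by simp)
    (fun _ => by simp)).mul_left ‖z‖
  refine h.congr fun n => ?_
  simp [mul_assoc]

theorem multipliable_poch₂ {p r : ℂ} (hp : ‖p‖ < 1) (hr : ‖r‖ < 1) (z : ℂ) :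
    Multipliable fun n : ℕ × ℕ => 1 - z * p ^ n.1 * r ^ n.2 := by
  simpa only [← sub_eq_add_neg] using
    multipliable_one_add_of_summable (summable_norm_poch₂ hp hr z)

theorem poch₂_ne_zero {p r : ℂ} (hp : ‖p‖ < 1) (hr : ‖r‖ < 1) {z : ℂ}
    (hz : ∀ m n : ℕ, z * p ^ m * r ^ n ≠ 1) : poch₂ z p r ≠ 0 := by
  have := tprod_one_add_ne_zero_of_summable (f := fun n : ℕ × ℕ => -(z * p ^ n.1 * r ^ n.2))
    (fun n h => hz n.1 n.2 (by linear_combination -h)) (summable_norm_poch₂ hp hr z)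
  simpa only [← sub_eq_add_neg, poch₂] using this

theorem poch₂_comm (z p r : ℂ) : poch₂ z p r = poch₂ z r p := by
  rw [poch₂, poch₂, ← (Equiv.prodComm ℕ ℕ).tprod_eq]
  exact tprod_congr fun n => by
    simp only [Equiv.prodComm_apply, Prod.fst_swap, Prod.snd_swap, mul_right_comm]

theorem poch₂_eq_mul_left {p r : ℂ} (hp : ‖p‖ < 1) (hr : ‖r‖ < 1) (z : ℂ) :
    poch₂ z p r = poch z r * poch₂ (p * z) p r := by
  -- Splits off the row where the exponent of $p$ is zero: the left summand is sent to exponents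
  -- $n+1$, the right one to $0$.
  let e : (ℕ × ℕ) ⊕ (Unit × ℕ) ≃ ℕ × ℕ :=
    (Equiv.sumProdDistrib ℕ Unit ℕ).symm.trans
      (Equiv.natSumPUnitEquivNat.prodCongr (Equiv.refl ℕ))
  have hm := multipliable_poch₂ hp hr z
  have hl : ∀ n : ℕ × ℕ, e (Sum.inl n) = (n.1 + 1, n.2) := fun _ => rfl
  have hr' : ∀ n : Unit × ℕ, e (Sum.inr n) = (0, n.2) := fun _ => rfl
  rw [poch₂, ← e.tprod_eq, Multipliable.tprod_sum]
  · simp only [hl, hr', pow_zero, mul_one]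
    rw [mul_comm]
    congr 1
    · rw [poch, ← (Equiv.punitProd ℕ).tprod_eq]
      rfl
    · exact tprod_congr fun n => by rw [pow_succ']; ring
  · refine (multipliable_poch₂ hp hr (p * z)).congr fun n => ?_
    simp only [Function.comp, hl]
    rw [pow_succ']; ring
  · refine ((Equiv.punitProd ℕ).multipliable_iff.2 (multipliable_poch hr z)).congr fun n => ?_
    simp [Function.comp, hr']

theorem poch₂_eq_mul_right {p r : ℂ} (hp : ‖p‖ < 1) (hr : ‖r‖ < 1) (z : ℂ) :
    poch₂ z p r = poch z p * poch₂ (r * z) p r := by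
  rw [poch₂_comm, poch₂_eq_mul_left hr hp, poch₂_comm]

/-! ### Regular parameters -/

theorem qpow_add (η x y : ℂ) : qpow η (x + y) = qpow η x * qpow η y := by
  ext; simp [qpow, mul_add, Complex.exp_add]

theorem qpow_neg (η x : ℂ) : qpow η (-x) = (qpow η x)⁻¹ := by
  ext; simp [qpow, Complex.exp_neg]

theorem qpow_zero (η : ℂ) : qpow η 0 = 1 := by
  ext; simp [qpow]

theorem qpow_four (η : ℂ) : (qpow η 4 : ℂ) = (qpow η 2 : ℂ) ^ 2 := by
  rw [show (4 : ℂ) = 2 + 2 by norm_num, qpow_add, Units.val_mul, sq]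

theorem norm_qpow_four_lt {η : ℂ} (hη : η.re < 0) : ‖(qpow η 4 : ℂ)‖ < 1 := by
  simp only [qpow, Units.val_mk0, Complex.norm_exp, Real.exp_lt_one_iff]
  simpa using mul_neg_of_neg_of_pos hη (by norm_num : (0 : ℝ) < 4)

theorem qpow_mul_intCast (η : ℂ) (x : ℂ) (n : ℤ) :
    (qpow η (x * n) : ℂ) = (qpow η x : ℂ) ^ n := by
  rw [qpow, qpow, Units.val_mk0, Units.val_mk0, ← Complex.exp_int_mul]
  ring_nf

theorem SpecReg.qpow_mul {η p z : ℂ} (hz : SpecReg η p z) (k : ℤ) :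
    SpecReg η p (qpow η k * z) := by
  intro m n h
  refine hz (m - k) n ?_
  have h0 := (qpow η k).ne_zero
  refine mul_left_cancel₀ h0 ?_
  rw [h, ← mul_assoc, ← Units.val_mul, ← qpow_add]
  push_cast
  ring_nf

theorem SpecReg.inv {η p z : ℂ} (hz : SpecReg η p z) : SpecReg η p z⁻¹ := by
  intro m n h
  refine hz (-m) (-n) ?_
  rw [← inv_inv z, h, mul_inv, Int.cast_neg, qpow_neg, Units.val_inv_eq_inv_val, _root_.zpow_neg]

/-- At an integral central charge, $p^*\in q^{\mathbb Z}p$, so regularity for $p$ already contains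
regularity for $p^*$. -/
theorem SpecReg.pstar {η p z : ℂ} (hz : SpecReg η p z) (k : ℤ) :
    SpecReg η (pstar η p k) z := by
  intro m n h
  refine hz (m + -2 * k * n) n ?_
  rw [h, EllipticB.pstar, mul_zpow, ← qpow_mul_intCast]
  push_cast
  rw [qpow_add, Units.val_mul]
  ring

theorem SpecReg.ne_zpow {η p z : ℂ} (hz : SpecReg η p z) (n : ℤ) : z ≠ p ^ n := by
  have h := hz 0 n
  rwa [Int.cast_zero, qpow_zero, Units.val_one, one_mul] at h

theorem SpecReg.theta_ne_zero {η p z : ℂ} (hz : SpecReg η p z) (hp₀ : p ≠ 0) (hp : ‖p‖ < 1)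
    (hz₀ : z ≠ 0) : theta p z ≠ 0 :=
  EllipticB.theta_ne_zero hp₀ hp hz₀ hz.ne_zpow

theorem SpecReg.poch₂_ne_zero {η p z : ℂ} (hz : SpecReg η p z) (hη : η.re < 0) (hp₀ : p ≠ 0)
    (hp : ‖p‖ < 1) (k l : ℤ) : poch₂ (qpow η k * p ^ l * z) p (qpow η 4) ≠ 0 := by
  refine EllipticB.poch₂_ne_zero hp (norm_qpow_four_lt hη) fun m n h => ?_
  refine hz (-k - 4 * n) (-l - m) ?_
  have h1 : (qpow η ((-k - 4 * n : ℤ) : ℂ) : ℂ) = (qpow η k : ℂ)⁻¹ * ((qpow η 4 : ℂ) ^ n)⁻¹ := by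
    have : (qpow η (4 * n) : ℂ) = (qpow η 4 : ℂ) ^ n := by
      simpa using qpow_mul_intCast η 4 n
    push_cast
    rw [sub_eq_add_neg, qpow_add, qpow_neg, qpow_neg, Units.val_mul, Units.val_inv_eq_inv_val,
      Units.val_inv_eq_inv_val, this]
  have h2 : p ^ (-l - m : ℤ) = (p ^ l)⁻¹ * (p ^ m)⁻¹ := by
    rw [zpow_sub₀ hp₀, _root_.zpow_neg, zpow_natCast, div_eq_mul_inv]
  have h3 := (qpow η k).ne_zero
  have h4 := (qpow η 4).ne_zero
  rw [h1, h2]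
  field_simp
  linear_combination h

theorem SpecReg.poch_ne_zero {η p z : ℂ} (hz : SpecReg η p z) (hp₀ : p ≠ 0) (hp : ‖p‖ < 1)
    (l : ℤ) : poch (p ^ l * z) p ≠ 0 := by
  refine EllipticB.poch_ne_zero hp fun n h => ?_
  refine hz.ne_zpow (-l - n) ?_
  rw [zpow_sub₀ hp₀, _root_.zpow_neg, zpow_natCast]
  field_simp
  linear_combination h

/-! ### The normalization factor -/

theorem rho_ne_zero {η p z : ℂ} (hη : η.re < 0) (hp₀ : p ≠ 0) (hp : ‖p‖ < 1)
    (hz : SpecReg η p z) : rho η p z ≠ 0 := by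
  have h := fun k l => hz.poch₂_ne_zero hη hp₀ hp k l
  have h' := fun k l => hz.inv.poch₂_ne_zero hη hp₀ hp k l
  have e1 := h 2 0
  have e2 := h' 0 1
  have e3 := h' 4 1
  have e4 := h' 2 1
  have e5 := h 0 0
  have e6 := h 4 0
  simp only [Int.cast_ofNat, Int.cast_zero, qpow_zero, Units.val_one, zpow_zero, zpow_one, mul_one,
    one_mul, ← div_eq_mul_inv] at e1 e2 e3 e4 e5 e6
  rw [mul_comm _ p] at e3 e4
  exact div_ne_zero (mul_ne_zero (Units.ne_zero _) (mul_ne_zero (mul_ne_zero (pow_ne_zero _ e1) e2) e3))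
    (mul_ne_zero (mul_ne_zero (pow_ne_zero _ e4) e5) e6)

/-- A shift by $q^4$ changes each double product by a single product in $p$; these assemble into
theta functions. This is the scalar part of crossing. -/
theorem rho_mul_theta {η p u : ℂ} (hη : η.re < 0) (hp₀ : p ≠ 0) (hp : ‖p‖ < 1) (hu₀ : u ≠ 0)
    (hu : SpecReg η p u) :
    rho η p u * (theta p u * theta p (qpow η 4 * u)) =
      rho η p (qpow η 4 * u) * theta p (qpow η 2 * u) ^ 2 := by
  have hr := norm_qpow_four_lt hη
  have ha := (qpow η 2).ne_zero
  have h := fun k l => hu.poch₂_ne_zero hη hp₀ hp k l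
  have h' := fun k l => hu.inv.poch₂_ne_zero hη hp₀ hp k l
  have e1 := h 8 0
  have e2 := h' 2 1
  have e3 := h 4 0
  have e4 := hu.poch_ne_zero hp₀ hp 0
  have e5 := (hu.qpow_mul 4).poch_ne_zero hp₀ hp 0
  have e6 := (hu.qpow_mul 2).inv.poch_ne_zero hp₀ hp 1
  simp only [Int.cast_ofNat, zpow_zero, zpow_one, mul_one,
    one_mul] at e1 e2 e3 e4 e5 e6
  have h8 : (qpow η 8 : ℂ) = qpow η 4 * qpow η 4 := by
    rw [show (8 : ℂ) = 4 + 4 by norm_num, qpow_add, Units.val_mul]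
  rw [h8] at e1
  have f1 := poch₂_eq_mul_right hp hr (qpow η 2 * u)
  have f2 := poch₂_eq_mul_right hp hr u
  have f3 := poch₂_eq_mul_right hp hr (qpow η 4 * u)
  have f4 := poch₂_eq_mul_right hp hr (p / (qpow η 4 * u))
  have f5 := poch₂_eq_mul_right hp hr (p / u)
  have f6 := poch₂_eq_mul_right hp hr (p * qpow η 2 / (qpow η 4 * u))
  have g1 : qpow η 4 * (p / (qpow η 4 * u)) = p / u := by
    have := (qpow η 4).ne_zero; field_simp
  have g2 : qpow η 4 * (p * qpow η 2 / (qpow η 4 * u)) = p * qpow η 2 / u := by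
    have := (qpow η 4).ne_zero; field_simp
  have g3 : p * qpow η 2 / (qpow η 4 * u) = p / (qpow η 2 * u) := by
    rw [qpow_four]; field_simp
  have g4 : p * qpow η 4 / (qpow η 4 * u) = p / u := by
    have := (qpow η 4).ne_zero; field_simp
  have g5 : qpow η 4 * (p / u) = p * qpow η 4 / u := by ring
  have g6 : (qpow η 2 : ℂ) * p * u⁻¹ = p * qpow η 2 / u := by ring
  have g7 : (qpow η 2 : ℂ) * (qpow η 4 * u) = qpow η 4 * (qpow η 2 * u) := by ring
  rw [g2] at f6
  rw [g3] at f6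
  rw [g1] at f4
  rw [g5] at f5
  rw [g6] at e2
  rw [← div_eq_mul_inv] at e6
  rw [mul_assoc] at e1
  simp only [rho, theta]
  rw [g3, g4, g7, f6, f4, f5, f1, f2, f3]
  generalize poch₂ (qpow η 4 * (qpow η 4 * u)) p (qpow η 4) = x1 at *
  generalize poch₂ (p * qpow η 2 / u) p (qpow η 4) = x2 at *
  field_simp

/-- The value of `ρ(z) ρ(z⁻¹)`. -/
def rhoNorm (η x : ℂ) : ℂ :=
  let r : ℂ := qpow η 4
  (qpow η (-(1 / 2)) : ℂ) ^ 2 * (poch (qpow η 2 * x) r * poch (qpow η 2 * x⁻¹) r) ^ 2 /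
    (poch x r * poch x⁻¹ r * (poch (r * x) r * poch (r * x⁻¹) r))

/-- The point is that the nome drops out: after one step in the $p$-direction the double products
cancel in pairs. The unitarity constants of the $R$-matrices with nomes $p$ and $p^*$ are thus given
by one function. -/
theorem rho_mul_rho_inv {η p x : ℂ} (hη : η.re < 0) (hp₀ : p ≠ 0) (hp : ‖p‖ < 1)
    (hx : SpecReg η p x) : rho η p x * rho η p x⁻¹ = rhoNorm η x := by
  have hr := norm_qpow_four_lt hη
  have h := fun k l => hx.poch₂_ne_zero hη hp₀ hp k l
  have h' := fun k l => hx.inv.poch₂_ne_zero hη hp₀ hp k l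
  have f := poch₂_eq_mul_left hp hr
  have e1 := h 0 0
  have e2 := h' 0 0
  have e3 := h 4 0
  have e4 := h' 4 0
  have e5 := h 2 1
  have e6 := h' 2 1
  simp only [Int.cast_ofNat, Int.cast_zero, qpow_zero, Units.val_one, zpow_zero, zpow_one, mul_one,
    one_mul, f x, f x⁻¹, f (qpow η 4 * x), f (qpow η 4 * x⁻¹), mul_ne_zero_iff] at e1 e2 e3 e4 e5 e6
  have g1 : ∀ a b : ℂ, p * a * b = p * (a * b) := fun a b => mul_assoc _ _ _
  have g2 : ∀ a b : ℂ, a * p * b = p * (a * b) := fun a b => by ring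
  rw [g2] at e5 e6
  simp only [rho, rhoNorm, div_eq_mul_inv p, div_eq_mul_inv (p * _), inv_inv, g1]
  rw [f x, f x⁻¹, f (qpow η 4 * x), f (qpow η 4 * x⁻¹), f (qpow η 2 * x), f (qpow η 2 * x⁻¹)]
  obtain ⟨a1, b1⟩ := e1
  obtain ⟨a2, b2⟩ := e2
  obtain ⟨a3, b3⟩ := e3
  obtain ⟨a4, b4⟩ := e4
  generalize poch₂ (p * x) p _ = c1 at *
  generalize poch₂ (p * x⁻¹) p _ = c2 at *
  generalize poch₂ (p * (qpow η 4 * x)) p _ = c3 at *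
  generalize poch₂ (p * (qpow η 4 * x⁻¹)) p _ = c4 at *
  generalize poch₂ (p * (qpow η 2 * x)) p _ = c5 at *
  generalize poch₂ (p * (qpow η 2 * x⁻¹)) p _ = c6 at *
  generalize poch x _ = d1 at *
  generalize poch x⁻¹ _ = d2 at *
  generalize poch (qpow η 4 * x) _ = d3 at *
  generalize poch (qpow η 4 * x⁻¹) _ = d4 at *
  generalize poch (qpow η 2 * x) _ = d5 at *
  generalize poch (qpow η 2 * x⁻¹) _ = d6 at *
  generalize (qpow η (-(1 / 2)) : ℂ) = y at *
  field_simp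

theorem rhoNorm_ne_zero {η p x : ℂ} (hη : η.re < 0) (hp₀ : p ≠ 0) (hp : ‖p‖ < 1)
    (hx : SpecReg η p x) : rhoNorm η x ≠ 0 := by
  rw [← rho_mul_rho_inv hη hp₀ hp hx]
  exact mul_ne_zero (rho_ne_zero hη hp₀ hp hx) (rho_ne_zero hη hp₀ hp hx.inv)

/-- Apply `rho_mul_theta` at $x$ and at $(q^4x)^{-1}$: by inversion the same theta quotient appears
in both equations, and it cancels. The nome only serves as an auxiliary parameter. -/
theorem rhoNorm_qpow_four_mul {η p x : ℂ} (hη : η.re < 0) (hp₀ : p ≠ 0) (hp : ‖p‖ < 1)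
    (hx₀ : x ≠ 0) (hx : SpecReg η p x) : rhoNorm η (qpow η 4 * x) = rhoNorm η x := by
  have h4 := hx.qpow_mul 4
  have h2 := hx.qpow_mul 2
  simp only [Int.cast_ofNat] at h4 h2
  have ha := (qpow η 2).ne_zero
  have hb := (qpow η 4).ne_zero
  rw [← rho_mul_rho_inv hη hp₀ hp hx, ← rho_mul_rho_inv hη hp₀ hp h4]
  have e1 := rho_mul_theta hη hp₀ hp hx₀ hx
  have e2 := rho_mul_theta hη hp₀ hp (inv_ne_zero (mul_ne_zero hb hx₀)) h4.inv
  have g1 : (qpow η 4 : ℂ) * (qpow η 4 * x)⁻¹ = x⁻¹ := by field_simp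
  have g2 : (qpow η 2 : ℂ) * (qpow η 4 * x)⁻¹ = (qpow η 2 * x)⁻¹ := by
    rw [qpow_four]; field_simp
  rw [g1, g2, theta_inv hp hx₀, theta_inv hp (mul_ne_zero ha hx₀),
    theta_inv hp (mul_ne_zero hb hx₀)] at e2
  have t1 := hx.theta_ne_zero hp₀ hp hx₀
  have t2 := h2.theta_ne_zero hp₀ hp (mul_ne_zero ha hx₀)
  have t3 := h4.theta_ne_zero hp₀ hp (mul_ne_zero hb hx₀)
  rw [qpow_four] at *
  generalize theta p x = T1 at *
  generalize theta p (qpow η 2 * x) = T2 at *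
  generalize theta p ((qpow η 2 : ℂ) ^ 2 * x) = T3 at *
  generalize rho η p x = r1 at *
  generalize rho η p x⁻¹ = r2 at *
  generalize rho η p ((qpow η 2 : ℂ) ^ 2 * x) = r3 at *
  generalize rho η p ((qpow η 2 : ℂ) ^ 2 * x)⁻¹ = r4 at *
  generalize (qpow η 2 : ℂ) = a at *
  field_simp at e2
  have e3 : r1 = r3 * T2 ^ 2 / (T1 * T3) := by field_simp; linear_combination e1
  have e4 : r4 = r2 * T2 ^ 2 / (T1 * T3) := by field_simp; linear_combination e2
  rw [e3, e4]
  ring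

/-! ### The entries of the `R`-matrix -/

/-- The diagonal entry `b` of the `R`-matrix, with `a = q ^ 2` and without the factor `ρ`. -/
def entryB (p a z w : ℂ) : ℂ := theta p (a * w) * theta p z / (theta p w * theta p (a * z))

/-- The off-diagonal entry `c` of the `R`-matrix, with `a = q ^ 2` and without the factor `ρ`. -/
def entryC (p a z w : ℂ) : ℂ := theta p a * theta p (w * z) / (theta p w * theta p (a * z))

/-- After inversion of the arguments, this is the three-term identity at $(a,w,z)$. -/
theorem entry_unitarity_diag {p a z w : ℂ} (hp₀ : p ≠ 0) (hp : ‖p‖ < 1) (ha : a ≠ 0)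
    (hz : z ≠ 0) (hw : w ≠ 0) (h1 : theta p w ≠ 0) (h2 : theta p (a * z) ≠ 0)
    (h3 : theta p (a * z⁻¹) ≠ 0) :
    entryB p a z w * entryB p a z⁻¹ w⁻¹ + entryC p a z w * entryC p a z⁻¹ w = 1 := by
  have h := theta_three_term hp₀ hp ha hw hz
  have i1 := theta_inv hp hz
  have i2 := theta_inv hp hw
  have i3 := theta_inv hp (div_ne_zero hz hw)
  rw [inv_div] at i3
  simp only [div_eq_mul_inv] at h i3
  simp only [entryB, entryC]
  rw [i1, i2, i3, mul_comm w z]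
  generalize theta p (a * z⁻¹) = x₁ at *
  generalize theta p (a * w⁻¹) = x₂ at *
  generalize theta p (z * w⁻¹) = x₃ at *
  generalize theta p (z * w) = x₄ at *
  field_simp at h ⊢
  linear_combination h

theorem entry_unitarity_offDiag {p a z w : ℂ} (hp : ‖p‖ < 1) (hz : z ≠ 0) (hw : w ≠ 0) :
    entryB p a z w * entryC p a z⁻¹ w⁻¹ + entryC p a z w * entryB p a z⁻¹ w = 0 := by
  have i1 := theta_inv hp hz
  have i2 := theta_inv hp hw
  have i3 := theta_inv hp (mul_ne_zero hz hw)
  rw [mul_inv, mul_comm z⁻¹] at i3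
  simp only [entryB, entryC]
  rw [i1, i2, i3, mul_comm w z]
  -- If a denominator vanishes, division by zero gives zero and both terms are zero.
  by_cases h1 : theta p w = 0
  · simp [h1]
  by_cases h2 : theta p (a * z) = 0
  · simp [h2]
  by_cases h3 : theta p (a * z⁻¹) = 0
  · simp [h3]
  field_simp
  ring

/-- The ratio `Υ(λ - σ_z) / Υ(λ)` up to a power of `q`, as a function of `w`. -/
def entryN (p a w : ℂ) : ℂ := theta p (w / a) / theta p w

/-- The only crossing entry with two summands and a nonzero value; it is the three-term identity at
$(w,a,au)$. The theta factors outside are those of `rho_mul_theta`. -/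
theorem entry_crossing_same {p a u w : ℂ} (hp₀ : p ≠ 0) (hp : ‖p‖ < 1) (ha : a ≠ 0)
    (hu : u ≠ 0) (hw : w ≠ 0) (h1 : theta p w ≠ 0) (h2 : theta p (a * w) ≠ 0)
    (h3 : theta p (a * u) ≠ 0) :
    theta p (a * u) ^ 2 * (entryN p a w +
      entryN p a w⁻¹ * (entryC p a (a ^ 2 * u)⁻¹ (a * w) * entryC p a u (a * w))) =
      theta p u * theta p (a ^ 2 * u) * entryN p a (a * w) := by
  have h := theta_three_term hp₀ hp hw ha (mul_ne_zero ha hu)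
  have i1 := theta_inv hp hw
  have i2 := theta_inv hp (mul_ne_zero ha hw)
  have i3 := theta_inv hp (mul_ne_zero ha hu)
  have g1 : w⁻¹ / a = (a * w)⁻¹ := by field_simp
  have g2 : a * (a ^ 2 * u)⁻¹ = (a * u)⁻¹ := by field_simp
  have g3 : a * w * (a ^ 2 * u)⁻¹ = w / (a * u) := by field_simp
  have g4 : a * w / a = w := by field_simp
  have g5 : a * u / a = u := by field_simp
  have g6 : a * u * a = a ^ 2 * u := by ring
  have g7 : w * (a * u) = a * w * u := by ring
  rw [g5, g6, g7, mul_comm w a] at h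
  simp only [entryN, entryC, g1, g2, g3, g4, i1, i2, i3]
  generalize theta p (a * w * u) = x₁ at *
  field_simp
  linear_combination h

/-- A single product of two entries; inversion alone suffices. -/
theorem entry_crossing_diag {p a u w : ℂ} (hp : ‖p‖ < 1) (ha : a ≠ 0)
    (hu : u ≠ 0) (hw : w ≠ 0) (h1 : theta p w ≠ 0) (h2 : theta p (w / a) ≠ 0)
    (h3 : theta p (a * u) ≠ 0) :
    theta p (a * u) ^ 2 * (entryN p a w *
      (entryB p a (a ^ 2 * u)⁻¹ (a * w⁻¹) * entryB p a u (w / a))) =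
      theta p u * theta p (a ^ 2 * u) * entryN p a (w / a) := by
  have i1 := theta_inv hp (div_ne_zero (div_ne_zero hw ha) ha)
  have i2 := theta_inv hp (div_ne_zero hw ha)
  have i3 := theta_inv hp (mul_ne_zero ha hu)
  have i4 := theta_inv hp (mul_ne_zero (pow_ne_zero 2 ha) hu)
  have g1 : a * (a * w⁻¹) = (w / a / a)⁻¹ := by field_simp
  have g2 : a * (a ^ 2 * u)⁻¹ = (a * u)⁻¹ := by field_simp
  have g3 : a * w⁻¹ = (w / a)⁻¹ := by field_simp
  have g4 : a * (w / a) = w := by field_simp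
  simp only [entryN, entryB, g1, g2, g4]
  rw [g3, i1, i2, i3, i4]
  field_simp

/-- The two summands are opposite by inversion. The weight $N$ is what makes them match. -/
theorem entry_crossing_offDiag {p a u w : ℂ} (hp : ‖p‖ < 1) (ha : a ≠ 0)
    (hu : u ≠ 0) (hw : w ≠ 0) (h1 : theta p w ≠ 0) (h2 : theta p (a * w) ≠ 0)
    (h3 : theta p (w / a) ≠ 0) (h4 : theta p (a * u) ≠ 0) :
    entryN p a w * entryC p a u (a * w⁻¹) +
      entryN p a w⁻¹ * entryC p a (a ^ 2 * u)⁻¹ (a * w) = 0 := by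
  have i1 := theta_inv hp hw
  have i2 := theta_inv hp (mul_ne_zero ha hw)
  have i3 := theta_inv hp (mul_ne_zero ha hu)
  have i4 := theta_inv hp (div_ne_zero hw ha)
  have i5 := theta_inv hp (div_ne_zero hw (mul_ne_zero ha hu))
  have g1 : w⁻¹ / a = (a * w)⁻¹ := by field_simp
  have g2 : a * (a ^ 2 * u)⁻¹ = (a * u)⁻¹ := by field_simp
  have g3 : a * w * (a ^ 2 * u)⁻¹ = w / (a * u) := by field_simp
  have g4 : a * w⁻¹ * u = (w / (a * u))⁻¹ := by field_simp
  have g5 : a * w⁻¹ = (w / a)⁻¹ := by field_simp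
  simp only [entryN, entryC, g1, g2, g3, g4]
  rw [g5, i1, i2, i3, i4, i5]
  generalize theta p (w / (a * u)) = x₁
  generalize theta p (a * w) = x₂ at *
  generalize theta p (w / a) = x₃ at *
  field_simp
  ring

section Entries

variable (η p z s : ℂ)

theorem Rmat_apply (i j : Fin 2 × Fin 2) : Rmat η p z s i j = rho η p z *
    (!![1, 0, 0, 0;
        0, entryB p (qpow η 2) z (qpow η (2 * s)), entryC p (qpow η 2) z (qpow η (2 * s)), 0;
        0, entryC p (qpow η 2) z (qpow η (2 * s) : ℂ)⁻¹,
          entryB p (qpow η 2) z (qpow η (2 * s) : ℂ)⁻¹, 0;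
        0, 0, 0, 1] : Matrix (Fin 4) (Fin 4) ℂ) (finProdFinEquiv i) (finProdFinEquiv j) := rfl

@[simp] theorem Rmat_00_00 : Rmat η p z s (0, 0) (0, 0) = rho η p z := by
  rw [Rmat_apply]; exact mul_one _
@[simp] theorem Rmat_11_11 : Rmat η p z s (1, 1) (1, 1) = rho η p z := by
  rw [Rmat_apply]; exact mul_one _
@[simp] theorem Rmat_01_01 : Rmat η p z s (0, 1) (0, 1) =
    rho η p z * entryB p (qpow η 2) z (qpow η (2 * s)) := rfl
@[simp] theorem Rmat_01_10 : Rmat η p z s (0, 1) (1, 0) =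
    rho η p z * entryC p (qpow η 2) z (qpow η (2 * s)) := rfl
@[simp] theorem Rmat_10_01 : Rmat η p z s (1, 0) (0, 1) =
    rho η p z * entryC p (qpow η 2) z (qpow η (2 * s) : ℂ)⁻¹ := rfl
@[simp] theorem Rmat_10_10 : Rmat η p z s (1, 0) (1, 0) =
    rho η p z * entryB p (qpow η 2) z (qpow η (2 * s) : ℂ)⁻¹ := rfl

/-- The `R`-matrix preserves the total weight. -/
theorem Rmat_eq_zero {a b c d : Fin 2} (h : (a : ℕ) + b ≠ c + d) :
    Rmat η p z s (a, b) (c, d) = 0 := by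
  rw [Rmat_apply]
  fin_cases a <;> fin_cases b <;> fin_cases c <;> fin_cases d <;>
    first
    | exact absurd rfl h
    | exact mul_zero _

end Entries

/-! ### Unitarity and crossing of the $R$-matrix. -/

theorem DynReg.add_intCast {η p s : ℂ} (hs : DynReg η p s) (k : ℤ) : DynReg η p (s + k) := by
  intro m n
  have := hs (k + m) n
  push_cast at this
  rwa [add_assoc]

theorem DynReg.theta_ne_zero {η p s : ℂ} (hs : DynReg η p s) (hp₀ : p ≠ 0) (hp : ‖p‖ < 1) :
    theta p (qpow η (2 * s)) ≠ 0 :=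
  EllipticB.theta_ne_zero hp₀ hp (Units.ne_zero _) fun n => by simpa using hs 0 n

/-- Swapping both index pairs turns $R_{12}$ into $R_{21}$. Exchanging the two basis vectors amounts
to $w\mapsto w^{-1}$, so two scalar identities, each used at $w$ and $w^{-1}$, cover the middle
block. -/
theorem Rmat_unitarity {η p z s : ℂ} (hη : η.re < 0) (hp₀ : p ≠ 0) (hp : ‖p‖ < 1) (hz₀ : z ≠ 0)
    (hz : SpecReg η p z) (hs : DynReg η p s) :
    Rmat η p z s * (Rmat η p z⁻¹ s).submatrix Prod.swap Prod.swap = rhoNorm η z • 1 := by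
  have ha := (qpow η 2).ne_zero
  have hw := (qpow η (2 * s)).ne_zero
  have h1 := hs.theta_ne_zero hp₀ hp
  have h1' : theta p (qpow η (2 * s) : ℂ)⁻¹ ≠ 0 := by
    rw [theta_inv hp hw]; exact mul_ne_zero (neg_ne_zero.2 (inv_ne_zero hw)) h1
  have h2 := (hz.qpow_mul 2).theta_ne_zero hp₀ hp (mul_ne_zero (Units.ne_zero _) hz₀)
  have h3 := (hz.inv.qpow_mul 2).theta_ne_zero hp₀ hp
    (mul_ne_zero (Units.ne_zero _) (inv_ne_zero hz₀))
  rw [Int.cast_ofNat] at h2 h3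
  have u1 := entry_unitarity_diag hp₀ hp ha hz₀ hw h1 h2 h3
  have u2 := entry_unitarity_diag hp₀ hp ha hz₀ (inv_ne_zero hw) h1' h2 h3
  have u3 := entry_unitarity_offDiag (a := qpow η 2) hp hz₀ hw
  have u4 := entry_unitarity_offDiag (a := qpow η 2) hp hz₀ (inv_ne_zero hw)
  rw [inv_inv] at u2 u4
  rw [← rho_mul_rho_inv hη hp₀ hp hz]
  ext ⟨a, b⟩ ⟨c, d⟩
  rw [mul_apply, Fintype.sum_prod_type, Fin.sum_univ_two, Fin.sum_univ_two, Fin.sum_univ_two]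
  fin_cases a <;> fin_cases b <;> fin_cases c <;> fin_cases d <;>
    simp [Rmat_eq_zero, Matrix.smul_apply, one_apply]
  · linear_combination rho η p z * rho η p z⁻¹ * u1
  · linear_combination rho η p z * rho η p z⁻¹ * u3
  · linear_combination rho η p z * rho η p z⁻¹ * u4
  · linear_combination rho η p z * rho η p z⁻¹ * u2

theorem Ups_sub_one_div {η p s : ℂ} :
    Ups η p (s - 1) / Ups η p s =
      qpow η 1 * entryN p (qpow η 2) (qpow η (2 * s)) := by
  have e1 : (qpow η (-(s - 1)) : ℂ) = qpow η 1 * qpow η (-s) := by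
    rw [← Units.val_mul, ← qpow_add]; ring_nf
  have e2 : (qpow η (2 * (s - 1)) : ℂ) = qpow η (2 * s) / qpow η 2 := by
    rw [eq_div_iff (Units.ne_zero _), ← Units.val_mul, ← qpow_add]; ring_nf
  have h2 := (qpow η (-s)).ne_zero
  rw [Ups, Ups, entryN, e1, e2]
  field_simp

/-- $\Upsilon$ is odd in $s$, which reduces this to `Ups_sub_one_div` at $-s$. -/
theorem Ups_add_one_div {η p s : ℂ} (hp : ‖p‖ < 1) :
    Ups η p (s + 1) / Ups η p s =
      qpow η 1 * entryN p (qpow η 2) (qpow η (2 * s) : ℂ)⁻¹ := by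
  have h : ∀ x, Ups η p (-x) = -Ups η p x := fun x => by
    have e : (qpow η (2 * -x) : ℂ) = (qpow η (2 * x) : ℂ)⁻¹ := by
      rw [mul_neg, qpow_neg, Units.val_inv_eq_inv_val]
    have e' : (qpow η (2 * x) : ℂ) = qpow η x * qpow η x := by
      rw [two_mul, qpow_add, Units.val_mul]
    have h0 := (qpow η x).ne_zero
    rw [Ups, Ups, e, theta_inv hp (Units.ne_zero _), neg_neg, qpow_neg, Units.val_inv_eq_inv_val, e']
    field_simp
  have h' := Ups_sub_one_div (η := η) (p := p) (s := -s)
  rw [show -s - 1 = -(s + 1) by ring, h, h, neg_div_neg_eq, mul_neg, qpow_neg,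
    Units.val_inv_eq_inv_val] at h'
  exact h'

/-- The crossing symmetry of the `R`-matrix. -/
theorem Rmat_crossing {η p u s : ℂ} (hη : η.re < 0) (hp₀ : p ≠ 0) (hp : ‖p‖ < 1) (hu₀ : u ≠ 0)
    (hu : SpecReg η p u) (hs : DynReg η p s) (b d k l : Fin 2) :
    ∑ i, ∑ f, Ups η p (s - sig i) / Ups η p s *
      (Rmat η p (qpow η 4 * u)⁻¹ (s - sig i) (b, i) (f, k) * Rmat η p u (s - sig i) (l, f) (i, d)) =
    rhoNorm η (qpow η 4 * u) *
      if b = d ∧ k = l then Ups η p (s + sig d - sig k) / Ups η p (s + sig d) else 0 := by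
  have ha := (qpow η 2).ne_zero
  have hw := (qpow η (2 * s)).ne_zero
  have hm : (qpow η (2 * (s - 1)) : ℂ) = qpow η (2 * s) / qpow η 2 := by
    rw [eq_div_iff (Units.ne_zero _), ← Units.val_mul, ← qpow_add]; ring_nf
  have hq : (qpow η (2 * (s + 1)) : ℂ) = qpow η 2 * qpow η (2 * s) := by
    rw [← Units.val_mul, ← qpow_add]; ring_nf
  have h1 := hs.theta_ne_zero hp₀ hp
  have h2 := (hs.add_intCast 1).theta_ne_zero hp₀ hp
  have h3 := (hs.add_intCast (-1)).theta_ne_zero hp₀ hp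
  have h4 := (hu.qpow_mul 2).theta_ne_zero hp₀ hp (mul_ne_zero (Units.ne_zero _) hu₀)
  have h5 := hu.theta_ne_zero hp₀ hp hu₀
  have h6 := (hu.qpow_mul 4).theta_ne_zero hp₀ hp (mul_ne_zero (Units.ne_zero _) hu₀)
  have hr := rho_mul_theta hη hp₀ hp hu₀ hu
  have hn := rho_mul_rho_inv hη hp₀ hp (hu.qpow_mul 4)
  simp only [Int.cast_one, Int.cast_neg, ← sub_eq_add_neg, Int.cast_ofNat] at h2 h3 h4 h6 hn
  rw [hq] at h2
  rw [hm] at h3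
  have h1i : theta p (qpow η (2 * s) : ℂ)⁻¹ ≠ 0 := by
    rw [theta_inv hp hw]; exact mul_ne_zero (neg_ne_zero.2 (inv_ne_zero hw)) h1
  have h2i : theta p ((qpow η (2 * s) : ℂ)⁻¹ / qpow η 2) ≠ 0 := by
    rw [div_eq_inv_mul, ← mul_inv, theta_inv hp (mul_ne_zero ha hw)]
    exact mul_ne_zero (neg_ne_zero.2 (inv_ne_zero (mul_ne_zero ha hw))) h2
  have h3i : theta p (qpow η 2 * (qpow η (2 * s) : ℂ)⁻¹) ≠ 0 := by
    rw [← div_eq_mul_inv, ← inv_div, theta_inv hp (div_ne_zero hw ha)]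
    exact mul_ne_zero (neg_ne_zero.2 (inv_ne_zero (div_ne_zero hw ha))) h3
  have c1 := entry_crossing_same hp₀ hp ha hu₀ hw h1 h2 h4
  have c1i := entry_crossing_same hp₀ hp ha hu₀ (inv_ne_zero hw) h1i h3i h4
  have c2 := entry_crossing_diag hp ha hu₀ hw h1 h3 h4
  have c2i := entry_crossing_diag hp ha hu₀ (inv_ne_zero hw) h1i h2i h4
  have c3 := entry_crossing_offDiag hp ha hu₀ hw h1 h2 h3 h4
  have c3i := entry_crossing_offDiag hp ha hu₀ (inv_ne_zero hw) h1i h3i h2i h4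
  rw [← qpow_four] at c1 c1i c2 c2i c3 c3i
  rw [inv_inv] at c1i c2i c3i
  -- Trades the theta prefactors of the entry identities for $\rho(u)$ and $\rho(q^4u)$; the
  -- remaining factor $\rho((q^4u)^{-1})$ then completes the unitarity constant.
  have key : ∀ {X Y : ℂ}, theta p (qpow η 2 * u) ^ 2 * X =
      theta p u * theta p (qpow η 4 * u) * Y → rho η p u * X = rho η p (qpow η 4 * u) * Y := by
    intro X Y h
    refine mul_left_cancel₀ (mul_ne_zero h5 h6) ?_
    linear_combination X * hr + rho η p (qpow η 4 * u) * h
  have t1 : Ups η p s / Ups η p (s + 1) =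
      qpow η 1 * entryN p (qpow η 2) (qpow η 2 * qpow η (2 * s)) := by
    rw [← hq, ← Ups_sub_one_div, add_sub_cancel_right]
  have s0 : ∀ x : ℂ, x - sig 0 = x - 1 := fun x => rfl
  have s1 : ∀ x : ℂ, x - sig 1 = x + 1 := fun x => by simp [sig]
  have s2 : ∀ x : ℂ, x + sig 0 = x + 1 := fun x => rfl
  have s3 : ∀ x : ℂ, x + sig 1 = x - 1 := fun x => by simp [sig, sub_eq_add_neg]
  have j1 : ((qpow η (2 * s) : ℂ) / qpow η 2)⁻¹ = qpow η 2 * (qpow η (2 * s) : ℂ)⁻¹ := by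
    field_simp
  have t2 : Ups η p s / Ups η p (s - 1) =
      qpow η 1 * entryN p (qpow η 2) (qpow η 2 * (qpow η (2 * s) : ℂ)⁻¹) := by
    rw [← j1, ← hm, ← Ups_add_one_div hp, sub_add_cancel]
  have j2 : ((qpow η 2 : ℂ) * qpow η (2 * s))⁻¹ = (qpow η (2 * s) : ℂ)⁻¹ / qpow η 2 := by
    field_simp
  generalize ((qpow η 4 : ℂ) * u)⁻¹ = v at *
  rw [← hn, Fin.sum_univ_two, Fin.sum_univ_two, Fin.sum_univ_two]
  fin_cases b <;> fin_cases d <;> fin_cases k <;> fin_cases l <;>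
    simp [Rmat_eq_zero, Ups_sub_one_div, Ups_add_one_div hp, s0, s1, s2, s3, hm, hq, j1, j2]
  · rw [t1]
    linear_combination qpow η 1 * rho η p v * key c1
  · linear_combination qpow η 1 * rho η p v * key c2i
  · linear_combination qpow η 1 * rho η p v * rho η p u * c3
  · linear_combination qpow η 1 * rho η p v * rho η p u * c3i
  · linear_combination qpow η 1 * rho η p v * key c2
  · rw [t2]
    linear_combination qpow η 1 * rho η p v * key c1i

/-! ### Dynamical exchange relations over an arbitrary algebra -/

section Exchange

variable {A : Type*} [Ring A]

/-- `M₁`, where the matrix `M` depends on the index of the second tensor factor. -/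
def onFst (M : Fin 2 → Matrix (Fin 2) (Fin 2) A) :
    Matrix (Fin 2 × Fin 2) (Fin 2 × Fin 2) A := blockDiagonal M

/-- `M₂`, where the matrix `M` depends on the index of the first tensor factor. -/
def onSnd (M : Fin 2 → Matrix (Fin 2) (Fin 2) A) :
    Matrix (Fin 2 × Fin 2) (Fin 2 × Fin 2) A := (blockDiagonal M).submatrix Prod.swap Prod.swap

theorem onFst_apply (M : Fin 2 → Matrix (Fin 2) (Fin 2) A) (a b c d : Fin 2) :
    onFst M (a, b) (c, d) = if b = d then M b a c else 0 := rfl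

theorem onSnd_apply (M : Fin 2 → Matrix (Fin 2) (Fin 2) A) (a b c d : Fin 2) :
    onSnd M (a, b) (c, d) = if a = c then M a b d else 0 := rfl

theorem onFst_mul (M N : Fin 2 → Matrix (Fin 2) (Fin 2) A) :
    onFst M * onFst N = onFst fun b => M b * N b :=
  (blockDiagonal_mul M N).symm

theorem onFst_one : onFst (fun _ => (1 : Matrix (Fin 2) (Fin 2) A)) = 1 :=
  blockDiagonal_one

theorem submatrix_swap_mul {R : Type*} [Semiring R]
    (M N : Matrix (Fin 2 × Fin 2) (Fin 2 × Fin 2) R) :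
    (M * N).submatrix Prod.swap Prod.swap =
      M.submatrix Prod.swap Prod.swap * N.submatrix Prod.swap Prod.swap :=
  (submatrix_mul_equiv M N Prod.swap (Equiv.prodComm (Fin 2) (Fin 2)) Prod.swap).symm

theorem submatrix_swap_one {R : Type*} [Semiring R] :
    (1 : Matrix (Fin 2 × Fin 2) (Fin 2 × Fin 2) R).submatrix Prod.swap Prod.swap = 1 :=
  submatrix_one_equiv (Equiv.prodComm (Fin 2) (Fin 2))

theorem submatrix_swap_swap {R : Type*} (M : Matrix (Fin 2 × Fin 2) (Fin 2 × Fin 2) R) :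
    (M.submatrix Prod.swap Prod.swap).submatrix Prod.swap Prod.swap = M := by
  ext ⟨a, b⟩ ⟨c, d⟩; rfl

theorem onFst_submatrix_swap (M : Fin 2 → Matrix (Fin 2) (Fin 2) A) :
    (onFst M).submatrix Prod.swap Prod.swap = onSnd M := rfl

theorem onSnd_submatrix_swap (M : Fin 2 → Matrix (Fin 2) (Fin 2) A) :
    (onSnd M).submatrix Prod.swap Prod.swap = onFst M := submatrix_swap_swap _

theorem onFst_mul_onSnd_apply (M N : Fin 2 → Matrix (Fin 2) (Fin 2) A) (a b c d : Fin 2) :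
    (onFst M * onSnd N) (a, b) (c, d) = M b a c * N c b d := by
  rw [mul_apply, Fintype.sum_prod_type, Finset.sum_eq_single c, Finset.sum_eq_single b]
  · simp [onFst_apply, onSnd_apply]
  · intro f _ hf; simp [onFst_apply, hf.symm]
  · simp
  · intro e _ he
    exact Finset.sum_eq_zero fun f _ => by simp [onSnd_apply, he]
  · simp

theorem onSnd_mul_onFst_apply (M N : Fin 2 → Matrix (Fin 2) (Fin 2) A) (a b c d : Fin 2) :
    (onSnd M * onFst N) (a, b) (c, d) = M a b d * N d a c := by
  rw [mul_apply, Fintype.sum_prod_type, Finset.sum_eq_single a, Finset.sum_eq_single d]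
  · simp [onFst_apply, onSnd_apply]
  · intro f _ hf; simp [onFst_apply, hf]
  · simp
  · intro e _ he
    exact Finset.sum_eq_zero fun f _ => by simp [onSnd_apply, he.symm]
  · simp

theorem onSnd_mul_apply (M : Fin 2 → Matrix (Fin 2) (Fin 2) A)
    (N : Matrix (Fin 2 × Fin 2) (Fin 2 × Fin 2) A) (a b : Fin 2) (j : Fin 2 × Fin 2) :
    (onSnd M * N) (a, b) j = ∑ f, M a b f * N (a, f) j := by
  rw [mul_apply, Fintype.sum_prod_type, Finset.sum_eq_single a]
  · simp [onSnd_apply]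
  · intro e _ he
    exact Finset.sum_eq_zero fun f _ => by simp [onSnd_apply, he.symm]
  · simp

theorem onFst_mul_apply (M : Fin 2 → Matrix (Fin 2) (Fin 2) A)
    (N : Matrix (Fin 2 × Fin 2) (Fin 2 × Fin 2) A) (a b : Fin 2) (j : Fin 2 × Fin 2) :
    (onFst M * N) (a, b) j = ∑ e, M b a e * N (e, b) j := by
  rw [mul_apply, Fintype.sum_prod_type]
  refine Finset.sum_congr rfl fun e _ => ?_
  rw [Finset.sum_eq_single b]
  · simp [onFst_apply]
  · intro f _ hf; simp [onFst_apply, hf.symm]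
  · simp

variable [Algebra ℂ A]

/-- The exchange relation `Q L₁(λ) M₂(λ + σ_z⁽¹⁾) = M₂(λ) L₁(λ + σ_z⁽²⁾) T`. -/
def Exchange (Q : Matrix (Fin 2 × Fin 2) (Fin 2 × Fin 2) A)
    (L M : ℂ → Matrix (Fin 2) (Fin 2) A) (T : Matrix (Fin 2 × Fin 2) (Fin 2 × Fin 2) ℂ)
    (s : ℂ) : Prop :=
  Q * onFst (fun _ => L s) * onSnd (fun a => M (s + sig a)) =
    onSnd (fun _ => M s) * onFst (fun b => L (s + sig b)) * T.map (algebraMap ℂ A)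

/-- Two exchange relations with the same left factor `Q` give an exchange relation
for `L⁻¹ L'`. -/
theorem Exchange.inv_mul {Q Q' : Matrix (Fin 2 × Fin 2) (Fin 2 × Fin 2) A}
    {L Li L' M : ℂ → Matrix (Fin 2) (Fin 2) A}
    {T S R : Matrix (Fin 2 × Fin 2) (Fin 2 × Fin 2) ℂ} {s : ℂ} (hQ : Q' * Q = 1)
    (hL : ∀ s, L s * Li s = 1) (hL' : ∀ s, Li s * L s = 1) (hT : T * S = 1)
    (h : Exchange Q L M T s) (h' : Exchange Q L' M R s) :
    onFst (fun _ => Li s * L' s) * onSnd (fun a => M (s + sig a)) =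
      onSnd (fun a => M (s + sig a)) * S.map (algebraMap ℂ A) *
        onFst (fun b => Li (s + sig b) * L' (s + sig b)) * R.map (algebraMap ℂ A) := by
  have hTS : T.map (algebraMap ℂ A) * S.map (algebraMap ℂ A) = 1 := by
    rw [← Matrix.map_mul, hT, Matrix.map_one _ (map_zero _) (map_one _)]
  have hLL : onFst (fun _ => Li s) * onFst (fun _ => L s) = 1 := by
    rw [onFst_mul]; simp only [hL', onFst_one]
  have hLL' : onFst (fun b => L (s + sig b)) * onFst (fun b => Li (s + sig b)) = 1 := by
    rw [onFst_mul]; simp only [hL, onFst_one]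
  have hc : ∀ X Y : Matrix (Fin 2 × Fin 2) (Fin 2 × Fin 2) A,
      Q * onFst (fun _ => L s) * X = Q * onFst (fun _ => L s) * Y → X = Y := fun X Y hXY => by
    have := congrArg (fun Z => onFst (fun _ => Li s) * (Q' * Z)) hXY
    simp only [← mul_assoc] at this
    simpa only [mul_assoc (onFst _) Q' Q, hQ, mul_one, hLL, one_mul] using this
  unfold Exchange at h h'
  have hLs : onFst (fun _ => L s) * onFst (fun _ => Li s * L' s) = onFst (fun _ => L' s) := by
    rw [onFst_mul]; simp only [← mul_assoc, hL, one_mul]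
  -- It suffices to compare after left multiplication by $QL_1$: one side becomes the relation for
  -- $L'$, and the other follows by inserting $L_1TSL_1^{-1}=1$ and using the relation for $L$.
  refine hc _ _ ?_
  rw [← onFst_mul (fun b => Li (s + sig b))]
  calc _ = Q * (onFst (fun _ => L s) * onFst (fun _ => Li s * L' s)) *
        onSnd (fun a => M (s + sig a)) := by simp only [mul_assoc]
    _ = onSnd (fun _ => M s) * onFst (fun b => L' (s + sig b)) * R.map (algebraMap ℂ A) := by
        rw [hLs, h']
    _ = onSnd (fun _ => M s) * (onFst (fun b => L (s + sig b)) *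
        (T.map (algebraMap ℂ A) * S.map (algebraMap ℂ A)) * onFst (fun b => Li (s + sig b))) *
          onFst (fun b => L' (s + sig b)) * R.map (algebraMap ℂ A) := by
        rw [hTS, mul_one, hLL', mul_one]
    _ = (onSnd (fun _ => M s) * onFst (fun b => L (s + sig b)) * T.map (algebraMap ℂ A)) *
        (S.map (algebraMap ℂ A) * (onFst (fun b => Li (s + sig b)) *
          onFst (fun b => L' (s + sig b))) * R.map (algebraMap ℂ A)) := by
        simp only [mul_assoc]
    _ = _ := by rw [← h]; simp only [mul_assoc]

theorem Rmat_mul_inv {η p u s : ℂ} (hη : η.re < 0) (hp₀ : p ≠ 0) (hp : ‖p‖ < 1) (hu₀ : u ≠ 0)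
    (hu : SpecReg η p u) (hs : DynReg η p s) :
    Rmat η p u s * ((rhoNorm η u)⁻¹ • (Rmat η p u⁻¹ s).submatrix Prod.swap Prod.swap) = 1 := by
  rw [mul_smul_comm, Rmat_unitarity hη hp₀ hp hu₀ hu hs, smul_smul,
    inv_mul_cancel₀ (rhoNorm_ne_zero hη hp₀ hp hu), one_smul]

/-- The dynamical trace of a matrix `X` that satisfies an exchange relation with `M`, with
`R`-matrices related by crossing, commutes with `M` up to a dynamical shift. -/
theorem trace_mul_of_exchange {η p u s : ℂ} (hη : η.re < 0) (hp₀ : p ≠ 0) (hp : ‖p‖ < 1)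
    (hu₀ : u ≠ 0) (hu : SpecReg η p u) (hs : DynReg η p s) (X M : ℂ → Matrix (Fin 2) (Fin 2) A)
    (h : ∀ i, onFst (fun _ => X (s - sig i)) * onSnd (fun a => M (s - sig i + sig a)) =
      onSnd (fun a => M (s - sig i + sig a)) *
        ((rhoNorm η (qpow η 4 * u))⁻¹ • (Rmat η p (qpow η 4 * u)⁻¹ (s - sig i)).submatrix
          Prod.swap Prod.swap).map (algebraMap ℂ A) *
        onFst (fun b => X (s - sig i + sig b)) *
          (Rmat η p u (s - sig i)).map (algebraMap ℂ A)) (b d : Fin 2) :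
    (∑ i, algebraMap ℂ A (Ups η p (s - sig i) / Ups η p s) * X (s - sig i) i i) * M s b d =
      M s b d * ∑ k, algebraMap ℂ A (Ups η p (s + sig d - sig k) / Ups η p (s + sig d)) *
        X (s + sig d - sig k) k k := by
  have hn : rhoNorm η (qpow η 4 * u) ≠ 0 := by
    have := rhoNorm_ne_zero hη hp₀ hp (hu.qpow_mul 4)
    rwa [Int.cast_ofNat] at this
  set n := rhoNorm η (qpow η 4 * u) with hn_def
  set v := ((qpow η 4 : ℂ) * u)⁻¹ with hv
  have hent : ∀ i, X (s - sig i) i i * M s b d = ∑ b', ∑ k, ∑ l, ∑ f,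
      (n⁻¹ * (Rmat η p v (s - sig i) (b', i) (f, k) * Rmat η p u (s - sig i) (l, f) (i, d))) •
        (M s b b' * X (s + sig b' - sig k) k l) := by
    intro i
    -- At the point $s-\sigma_i$ and with first index $i$, the shifted argument of $M$ returns to
    -- $s$; hence the conjugation by $e^{\sigma_z\partial}$ in the trace.
    have hi := congrFun (congrFun (h i) (i, b)) (i, d)
    rw [onFst_mul_onSnd_apply, sub_add_cancel] at hi
    rw [hi, mul_assoc, mul_assoc, onSnd_mul_apply]
    refine Finset.sum_congr rfl fun b' _ => ?_
    rw [mul_apply, Fintype.sum_prod_type, Finset.mul_sum]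
    refine Finset.sum_congr rfl fun k _ => ?_
    simp only [onFst_mul_apply, Finset.mul_sum]
    rw [Finset.sum_comm]
    refine Finset.sum_congr rfl fun l _ => Finset.sum_congr rfl fun f _ => ?_
    simp only [Matrix.map_apply, Matrix.smul_apply, submatrix_apply, Prod.swap_prod_mk, smul_eq_mul,
      sub_add_cancel]
    -- Weight conservation lets the argument of $X$ be written without $i$ and $f$, so that the sum
    -- over these two indices involves only the $R$-matrices and crossing applies.
    by_cases hw : (b' : ℕ) + i = f + k
    · have hsig : s - sig i + sig f = s + sig b' - sig k := by
        fin_cases i <;> fin_cases b' <;> fin_cases f <;> fin_cases k <;>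
          first
          | exact absurd hw (by decide)
          | (simp [sig]; try ring)
      rw [hsig, ← Algebra.commutes (Rmat η p u _ _ _), ← Algebra.smul_def, ← Algebra.smul_def,
        mul_smul_comm, mul_smul_comm, smul_smul, mul_assoc]
    · rw [Rmat_eq_zero η p v _ hw]
      simp
  have hcr := Rmat_crossing hη hp₀ hp hu₀ hu hs
  rw [← hn_def, ← hv] at hcr
  calc _ = ∑ b', ∑ k, ∑ l, (n⁻¹ * ∑ i, ∑ f, Ups η p (s - sig i) / Ups η p s *
        (Rmat η p v (s - sig i) (b', i) (f, k) * Rmat η p u (s - sig i) (l, f) (i, d))) •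
        (M s b b' * X (s + sig b' - sig k) k l) := by
        simp only [Finset.sum_mul, ← Algebra.smul_def, smul_mul_assoc, hent, Finset.smul_sum, smul_smul,
          Finset.mul_sum, Finset.sum_smul]
        rw [Finset.sum_comm]
        refine Finset.sum_congr rfl fun b' _ => ?_
        rw [Finset.sum_comm]
        refine Finset.sum_congr rfl fun k _ => ?_
        rw [Finset.sum_comm]
        refine Finset.sum_congr rfl fun l _ => Finset.sum_congr rfl fun i _ =>
          Finset.sum_congr rfl fun f _ => ?_
        congr 1
        ring
    _ = M s b d * _ := by
        simp only [hcr, inv_mul_cancel_left₀ hn]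
        rw [Finset.sum_eq_single d (fun b' _ hb => by simp [hb]) (by simp), Finset.mul_sum]
        refine Finset.sum_congr rfl fun k _ => ?_
        rw [Finset.sum_eq_single k (fun l _ hl => by simp [hl.symm]) (by simp), ← Algebra.smul_def,
          mul_smul_comm]
        simp
end Exchange

/-! ### The relations of the algebra -/

section Algebra

variable (η p c : ℂ) (W : Set ℂ)

/-- The homomorphism `f ↦ f(h)`. -/
def fhHom : (ℂ → ℂ) →+* B η p c W where
  toFun f := RingQuot.mkAlgHom ℂ (Rel η p c W) (gfh f)
  map_one' := by
    have := RingQuot.mkAlgHom_rel ℂ (Rel.fh_const (η := η) (p := p) (c := c) (W := W) 1)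
    rw [map_one, map_one] at this
    exact this
  map_zero' := by
    have := RingQuot.mkAlgHom_rel ℂ (Rel.fh_const (η := η) (p := p) (c := c) (W := W) 0)
    rw [map_zero, map_zero] at this
    exact this
  map_mul' f g := by
    have := RingQuot.mkAlgHom_rel ℂ (Rel.fh_mul (η := η) (p := p) (c := c) (W := W) f g)
    rw [map_mul] at this
    exact this
  map_add' f g := by
    have := RingQuot.mkAlgHom_rel ℂ (Rel.fh_add (η := η) (p := p) (c := c) (W := W) f g)
    rw [map_add] at this
    exact this

theorem fhHom_congr {f g : ℂ → ℂ} (h : Set.EqOn f g W) : fhHom η p c W f = fhHom η p c W g :=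
  RingQuot.mkAlgHom_rel ℂ (Rel.fh_congr f g h)

theorem fhHom_const (a : ℂ) : fhHom η p c W (fun _ => a) = algebraMap ℂ _ a := by
  have := RingQuot.mkAlgHom_rel ℂ (Rel.fh_const (η := η) (p := p) (c := c) (W := W) a)
  rwa [AlgHom.commutes] at this

/-- The matrix `R(x, λ + h)`, with nome `p*`. -/
def Rdyn (x s : ℂ) : Matrix (Fin 2 × Fin 2) (Fin 2 × Fin 2) (B η p c W) :=
  of fun i j => fhHom η p c W fun μ => Rmat η (pstar η p c) x (s + μ) i j

variable {η p c W}

theorem Rdyn_unitarity {x s : ℂ} (hη : η.re < 0) (hp₀ : pstar η p c ≠ 0) (hp : ‖pstar η p c‖ < 1)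
    (hx₀ : x ≠ 0) (hx : SpecReg η (pstar η p c) x)
    (hs : ∀ μ ∈ W, DynReg η (pstar η p c) (s + μ)) :
    Rdyn η p c W x s * (Rdyn η p c W x⁻¹ s).submatrix Prod.swap Prod.swap = rhoNorm η x • 1 := by
  ext i j
  have h : (Rdyn η p c W x s * (Rdyn η p c W x⁻¹ s).submatrix Prod.swap Prod.swap) i j =
      fhHom η p c W fun _ => (rhoNorm η x • (1 : Matrix (Fin 2 × Fin 2) (Fin 2 × Fin 2) ℂ)) i j := by
    rw [mul_apply]
    simp only [Rdyn, submatrix_apply, of_apply, ← map_mul, ← map_sum]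
    -- Since $f\mapsto f(h)$ is a ring homomorphism seeing only values on $W$, scalar unitarity at
    -- each weight suffices.
    refine fhHom_congr η p c W fun μ hμ => ?_
    rw [← Rmat_unitarity hη hp₀ hp hx₀ hx (hs μ hμ), mul_apply, Finset.sum_apply]
    rfl
  rw [h, fhHom_const]
  simp only [Matrix.smul_apply, one_apply]
  split_ifs <;> simp [Algebra.smul_def]

theorem Rdyn_inv_mul {x s : ℂ} (hη : η.re < 0) (hp₀ : pstar η p c ≠ 0) (hp : ‖pstar η p c‖ < 1)
    (hx₀ : x ≠ 0) (hx : SpecReg η (pstar η p c) x)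
    (hs : ∀ μ ∈ W, DynReg η (pstar η p c) (s + μ)) :
    ((rhoNorm η x⁻¹)⁻¹ • (Rdyn η p c W x⁻¹ s).submatrix Prod.swap Prod.swap) *
      Rdyn η p c W x s = 1 := by
  have h := congrArg (fun M => M.submatrix Prod.swap Prod.swap)
    (Rdyn_unitarity hη hp₀ hp (inv_ne_zero hx₀) hx.inv hs)
  simp only [submatrix_swap_mul, submatrix_swap_swap, inv_inv, submatrix_smul, Pi.smul_apply,
    submatrix_swap_one] at h
  rw [smul_mul_assoc, h, smul_smul, inv_mul_cancel₀ (rhoNorm_ne_zero hη hp₀ hp hx.inv), one_smul]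

theorem exchange_of_rel {ε ε' : Sgn} {z₁ z₂ : ℂˣ} {x x' s : ℂ}
    (h : ∀ a b i j, Rel η p c W (rllLeft η (pstar η p c) x ε ε' z₁ z₂ s a b i j)
      (rllRight η p x' ε ε' z₁ z₂ s a b i j)) :
    Exchange (Rdyn η p c W x s) (lax η p c W ε z₁) (lax η p c W ε' z₂) (Rmat η p x' s) s := by
  ext ⟨a, b⟩ ⟨i, j⟩
  have hab := RingQuot.mkAlgHom_rel ℂ (h a b i j)
  simp only [rllLeft, rllRight, map_sum, map_mul, map_smul] at hab
  rw [mul_assoc, mul_apply, mul_apply, Fintype.sum_prod_type, Fintype.sum_prod_type]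
  simp only [onFst_mul_onSnd_apply, onSnd_mul_onFst_apply, Matrix.map_apply]
  simp only [← Algebra.commutes, ← Algebra.smul_def]
  simp only [← mul_assoc] at hab ⊢
  exact hab

theorem exchange_rll (ε : Sgn) (z₁ z₂ : ℂˣ) {s : ℂ} {k : ℤ} (hk : c = k)
    (hz : SpecReg η p (z₁ / z₂)) (hs : DynReg η p s)
    (hs' : ∀ μ ∈ W, DynReg η (pstar η p c) (s + μ)) :
    Exchange (Rdyn η p c W (z₁ / z₂) s) (lax η p c W ε z₁) (lax η p c W ε z₂)
      (Rmat η p (z₁ / z₂) s) s :=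
  exchange_of_rel fun a b i j => Rel.rll ε z₁ z₂ s a b i j hz (hk ▸ hz.pstar k) hs hs'

theorem exchange_mixed (z₁ z₂ : ℂˣ) {s : ℂ} {k : ℤ} (hk : c = k)
    (hz : SpecReg η p (z₁ / z₂)) (hs : DynReg η p s)
    (hs' : ∀ μ ∈ W, DynReg η (pstar η p c) (s + μ)) :
    Exchange (Rdyn η p c W (qpow η c * (z₁ / z₂)) s) (lax η p c W Sgn.plus z₁)
      (lax η p c W Sgn.minus z₂) (Rmat η p (qpow η (-c) * (z₁ / z₂)) s) s := by
  refine exchange_of_rel fun a b i j => Rel.rll_mixed z₁ z₂ s a b i j ?_ ?_ hs hs'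
  · have := hz.qpow_mul (-k)
    rwa [Int.cast_neg, ← hk] at this
  · have := (hz.qpow_mul k).pstar k
    rwa [← hk] at this

/-- The mixed relation with the two tensor factors interchanged. -/
theorem exchange_mixed_flip (hη : η.re < 0) (hp₀ : p ≠ 0) (hp : ‖p‖ < 1) (hp' : ‖pstar η p c‖ < 1)
    (y₁ y₂ : ℂˣ) {s : ℂ} {k : ℤ} (hk : c = k) (hz : SpecReg η p (y₁ / y₂)) (hs : DynReg η p s)
    (hs' : ∀ μ ∈ W, DynReg η (pstar η p c) (s + μ))
    (hn : rhoNorm η (qpow η (-c) * (y₁ / y₂)) = rhoNorm η (qpow η c * (y₁ / y₂))) :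
    Exchange (Rdyn η p c W (qpow η (-c) * (y₁ / y₂)) s) (lax η p c W Sgn.minus y₁)
      (lax η p c W Sgn.plus y₂) (Rmat η p (qpow η c * (y₁ / y₂)) s) s := by
  have hx₀ : (y₁ / y₂ : ℂ) ≠ 0 := div_ne_zero y₁.ne_zero y₂.ne_zero
  have hps₀ : pstar η p c ≠ 0 := mul_ne_zero hp₀ (Units.ne_zero _)
  have hinv : (y₂ / y₁ : ℂ) = (y₁ / y₂ : ℂ)⁻¹ := (inv_div _ _).symm
  have h := exchange_mixed (W := W) y₂ y₁ hk (by rw [hinv]; exact hz.inv) hs hs'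
  unfold Exchange at h ⊢
  rw [hinv] at h
  generalize (y₁ / y₂ : ℂ) = x at *
  have e1 : (qpow η c : ℂ) * x⁻¹ = (qpow η (-c) * x)⁻¹ := by
    rw [mul_inv, qpow_neg, Units.val_inv_eq_inv_val, inv_inv]
  have e2 : (qpow η (-c) : ℂ) * x⁻¹ = (qpow η c * x)⁻¹ := by
    rw [mul_inv, qpow_neg, Units.val_inv_eq_inv_val]
  have r1 : SpecReg η p (qpow η c * x) := hk ▸ hz.qpow_mul k
  have r2 : SpecReg η p (qpow η (-c) * x) := by
    have := hz.qpow_mul (-k)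
    rwa [Int.cast_neg, ← hk] at this
  have n1 := rhoNorm_ne_zero hη hp₀ hp r1
  rw [e1, e2] at h
  have hQ := Rdyn_unitarity hη hps₀ hp' (mul_ne_zero (Units.ne_zero _) hx₀)
    (hk ▸ r2.pstar k : SpecReg η (pstar η p c) (qpow η (-c) * x)) hs'
  have hR := congrArg (fun M => (M.submatrix Prod.swap Prod.swap).map (algebraMap ℂ (B η p c W)))
    (Rmat_unitarity hη hp₀ hp (inv_ne_zero (mul_ne_zero (Units.ne_zero _) hx₀)) r1.inv hs)
  have hsymm : rhoNorm η (qpow η c * x)⁻¹ = rhoNorm η (qpow η c * x) := by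
    rw [← rho_mul_rho_inv hη hp₀ hp r1.inv, ← rho_mul_rho_inv hη hp₀ hp r1, inv_inv, mul_comm]
  have hmap : ((rhoNorm η (qpow η c * x) • (1 : Matrix (Fin 2 × Fin 2) (Fin 2 × Fin 2) ℂ)).map
      (algebraMap ℂ (B η p c W))) = rhoNorm η (qpow η c * x) • 1 := by
    ext i j
    simp only [Matrix.map_apply, Matrix.smul_apply, one_apply]
    split_ifs <;> simp [Algebra.smul_def]
  simp only [submatrix_swap_mul, submatrix_swap_swap, inv_inv, submatrix_smul, Pi.smul_apply,
    submatrix_swap_one, hsymm, Matrix.map_mul, hmap] at hR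
  rw [hn] at hQ
  have h' := congrArg (fun M => M.submatrix Prod.swap Prod.swap) h
  simp only [submatrix_swap_mul, onFst_submatrix_swap, onSnd_submatrix_swap, submatrix_map] at h'
  -- The swapped relation is sandwiched between the inverses, up to scalars, of its own
  -- $R$-matrices. Unitarity leaves one scalar on each side; they agree by `hn` and cancel.
  have key := congrArg (fun M => Rdyn η p c W (qpow η (-c) * x) s * M *
    (Rmat η p (qpow η c * x) s).map (algebraMap ℂ (B η p c W))) h'
  refine smul_right_injective _ n1 ?_
  dsimp only at key ⊢
  rw [← mul_assoc, ← mul_assoc, hQ, smul_mul_assoc, smul_mul_assoc, smul_mul_assoc, one_mul] at key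
  rw [key]
  simp only [mul_assoc, hR, mul_smul_comm, mul_one]

theorem pstar_ne_zero (hp₀ : p ≠ 0) : pstar η p c ≠ 0 := mul_ne_zero hp₀ (Units.ne_zero _)

theorem DynReg.sub_sig {η p s : ℂ} (hs : DynReg η p s) (i : Fin 2) : DynReg η p (s - sig i) := by
  fin_cases i
  · simpa [sig, sub_eq_add_neg] using hs.add_intCast (-1)
  · simpa [sig] using hs.add_intCast 1

/-- The dynamical trace of `L^ε₁(y)⁻¹ L^ε₂(z₁)` commutes with `L^ε(z₂)` up to a dynamical shift if
the exchange relations of the two factors with `L^ε(z₂)` are related by crossing. -/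
theorem traceOp_smul_lax (hη : η.re < 0) (hp₀ : p ≠ 0) (hp : ‖p‖ < 1) (hp' : ‖pstar η p c‖ < 1)
    {ε₁ ε₂ ε : Sgn} {y z₁ z₂ : ℂˣ} {x u s : ℂ} {k : ℤ} (hk : c = k) (hx₀ : x ≠ 0) (hu₀ : u ≠ 0)
    (hx : SpecReg η p x) (hu : SpecReg η p u) (hs : DynReg η p s)
    (hs' : ∀ μ ∈ W, DynReg η (pstar η p c) (s + μ))
    (h₁ : ∀ s, DynReg η p s → (∀ μ ∈ W, DynReg η (pstar η p c) (s + μ)) →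
      Exchange (Rdyn η p c W x s) (lax η p c W ε₁ y) (lax η p c W ε z₂)
        (Rmat η p (qpow η 4 * u) s) s)
    (h₂ : ∀ s, DynReg η p s → (∀ μ ∈ W, DynReg η (pstar η p c) (s + μ)) →
      Exchange (Rdyn η p c W x s) (lax η p c W ε₂ z₁) (lax η p c W ε z₂) (Rmat η p u s) s) :
    traceOp η p c W (laxInv η p c W ε₁ y) (lax η p c W ε₂ z₁) 1 s • lax η p c W ε z₂ s =
      lax η p c W ε z₂ s * Matrix.diagonal fun j =>
        traceOp η p c W (laxInv η p c W ε₁ y) (lax η p c W ε₂ z₁) 1 (s + sig j) := by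
  ext b d
  rw [Matrix.smul_apply, mul_diagonal, smul_eq_mul, traceOp_eq]
  simp only [mulOp, LinearMap.mulLeft_apply, mul_one]
  refine trace_mul_of_exchange hη hp₀ hp hu₀ hu hs
    (fun s => laxInv η p c W ε₁ y s * lax η p c W ε₂ z₁ s) (lax η p c W ε z₂) (fun i => ?_) b d
  -- Regularity of $s$ covers all integer shifts, so the relations are also available at
  -- $s-\sigma_i$.
  have hsi := hs.sub_sig i
  have hsi' : ∀ μ ∈ W, DynReg η (pstar η p c) (s - sig i + μ) := fun μ hμ => by
    have := (hs' μ hμ).sub_sig i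
    rwa [add_sub_right_comm] at this
  have hu4 := hu.qpow_mul 4
  rw [Int.cast_ofNat] at hu4
  exact Exchange.inv_mul
    (Rdyn_inv_mul hη (pstar_ne_zero hp₀) hp' hx₀ (hk ▸ hx.pstar k) hsi')
    (lax_mul_laxInv η p c W ε₁ y) (laxInv_mul_lax η p c W ε₁ y)
    (Rmat_mul_inv hη hp₀ hp (mul_ne_zero (Units.ne_zero _) hu₀) hu4 hsi)
    (h₁ _ hsi hsi') (h₂ _ hsi hsi')

end Algebra

/-! ### The levels $c=-2$ and $c=2$. -/

theorem norm_pstar_neg_two_lt {η p : ℂ} (hη : η.re < 0) (hp : ‖p‖ < 1) :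
    ‖pstar η p (-2)‖ < 1 := by
  rw [pstar, norm_mul, show (-2 : ℂ) * -2 = 4 by norm_num]
  exact mul_lt_one_of_nonneg_of_lt_one_left (norm_nonneg _) hp (norm_qpow_four_lt hη).le

theorem qpow_two_mul_div (η : ℂ) (z₁ z₂ : ℂˣ) :
    ((qpow η 2 * z₁ : ℂˣ) : ℂ) / z₂ = qpow η 2 * (z₁ / z₂) := by
  rw [Units.val_mul, mul_div_assoc]

theorem qpow_neg_two_mul_qpow_two (η v : ℂ) : (qpow η (-2) : ℂ) * (qpow η 2 * v) = v := by
  rw [← mul_assoc, ← Units.val_mul, ← qpow_add, neg_add_cancel, qpow_zero, Units.val_one, one_mul]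

theorem qpow_two_mul_qpow_two (η v : ℂ) : (qpow η 2 : ℂ) * (qpow η 2 * v) = qpow η 4 * v := by
  rw [qpow_four]; ring

theorem qpow_four_mul_qpow_neg_two (η v : ℂ) :
    (qpow η 4 : ℂ) * (qpow η (-2) * v) = qpow η 2 * v := by
  rw [← mul_assoc, ← Units.val_mul, ← qpow_add]; norm_num

theorem rhoNorm_qpow_two_mul {η p v : ℂ} (hη : η.re < 0) (hp₀ : p ≠ 0) (hp : ‖p‖ < 1)
    (hv₀ : v ≠ 0) (hv : SpecReg η p v) :
    rhoNorm η (qpow η 2 * v) = rhoNorm η (qpow η (-2) * v) := by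
  have h := hv.qpow_mul (-2)
  rw [Int.cast_neg, Int.cast_ofNat] at h
  rw [← qpow_four_mul_qpow_neg_two]
  exact rhoNorm_qpow_four_mul hη hp₀ hp (mul_ne_zero (Units.ne_zero _) hv₀) h

/-- With $v=z_1/z_2$, the common left argument $x$ and the crossing parameter $u$ are $x=u=v$
against $L^-$, and $x=q^2v$, $u=q^{-2}v$ against $L^+$. Only the latter needs the flipped mixed
relation. -/
theorem t_smul_lax {η p : ℂ} (hη : η.re < 0) (hp₀ : p ≠ 0) (hp : ‖p‖ < 1) {W : Set ℂ} (ε : Sgn)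
    (z₁ z₂ : ℂˣ) {s : ℂ} (hz : SpecReg η p (z₁ / z₂)) (hs : DynReg η p s)
    (hs' : ∀ μ ∈ W, DynReg η (pstar η p (-2)) (s + μ)) :
    t η p (-2) W z₁ s • lax η p (-2) W ε z₂ s =
      lax η p (-2) W ε z₂ s * Matrix.diagonal fun j => t η p (-2) W z₁ (s + sig j) := by
  -- Here $p^*=pq^4$, so $|p^*|<1$ is automatic; at $c=2$, where $p^*=pq^{-4}$, it is an assumption.
  have hp' := norm_pstar_neg_two_lt hη hp
  have hk : (-2 : ℂ) = ((-2 : ℤ) : ℂ) := by norm_num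
  have hv₀ : (z₁ / z₂ : ℂ) ≠ 0 := div_ne_zero z₁.ne_zero z₂.ne_zero
  have h2 : SpecReg η p (qpow η 2 * (z₁ / z₂)) := hz.qpow_mul 2
  have h2' : SpecReg η p (qpow η (-2) * (z₁ / z₂)) := by
    have := hz.qpow_mul (-2)
    rwa [Int.cast_neg, Int.cast_ofNat] at this
  unfold t
  rw [neg_neg]
  cases ε with
  | minus =>
    refine traceOp_smul_lax hη hp₀ hp hp' hk hv₀ hv₀ hz hz hs hs' (fun s hs hs' => ?_)
      fun s hs hs' => exchange_rll _ _ _ hk hz hs hs'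
    have h := exchange_mixed (W := W) (qpow η 2 * z₁) z₂ hk
      (by rw [qpow_two_mul_div]; exact h2) hs hs'
    rwa [qpow_two_mul_div, neg_neg, qpow_neg_two_mul_qpow_two, qpow_two_mul_qpow_two] at h
  | plus =>
    refine traceOp_smul_lax hη hp₀ hp hp' hk (mul_ne_zero (Units.ne_zero _) hv₀)
      (mul_ne_zero (Units.ne_zero _) hv₀) h2 h2' hs hs' (fun s hs hs' => ?_) fun s hs hs' => ?_
    · have h := exchange_rll (W := W) Sgn.plus (qpow η 2 * z₁) z₂ hk
        (by rw [qpow_two_mul_div]; exact h2) hs hs'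
      rw [qpow_two_mul_div] at h
      rwa [qpow_four_mul_qpow_neg_two]
    · have h := exchange_mixed_flip (W := W) hη hp₀ hp hp' z₁ z₂ hk hz hs hs'
        (by rw [neg_neg]; exact rhoNorm_qpow_two_mul hη hp₀ hp hv₀ hz)
      rwa [neg_neg] at h

/-- The same parameters with the roles of $L^+$ and $L^-$ exchanged: $x=u=v$ against $L^+$, now
through the flipped relation, and $x=q^2v$, $u=q^{-2}v$ against $L^-$. -/
theorem tstar_smul_lax {η p : ℂ} (hη : η.re < 0) (hp₀ : p ≠ 0) (hp : ‖p‖ < 1)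
    (hp' : ‖pstar η p 2‖ < 1) {W : Set ℂ} (ε : Sgn)
    (z₁ z₂ : ℂˣ) {s : ℂ} (hz : SpecReg η p (z₁ / z₂)) (hs : DynReg η p s)
    (hs' : ∀ μ ∈ W, DynReg η (pstar η p 2) (s + μ)) :
    tstar η p 2 W z₁ s • lax η p 2 W ε z₂ s =
      lax η p 2 W ε z₂ s * Matrix.diagonal fun j => tstar η p 2 W z₁ (s + sig j) := by
  have hk : (2 : ℂ) = ((2 : ℤ) : ℂ) := by norm_num
  have hv₀ : (z₁ / z₂ : ℂ) ≠ 0 := div_ne_zero z₁.ne_zero z₂.ne_zero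
  have h2 : SpecReg η p (qpow η 2 * (z₁ / z₂)) := hz.qpow_mul 2
  have h2' : SpecReg η p (qpow η (-2) * (z₁ / z₂)) := by
    have := hz.qpow_mul (-2)
    rwa [Int.cast_neg, Int.cast_ofNat] at this
  unfold tstar
  cases ε with
  | plus =>
    refine traceOp_smul_lax hη hp₀ hp hp' hk hv₀ hv₀ hz hz hs hs' (fun s hs hs' => ?_)
      fun s hs hs' => exchange_rll _ _ _ hk hz hs hs'
    have h := exchange_mixed_flip (W := W) hη hp₀ hp hp' (qpow η 2 * z₁) z₂ hk
      (by rw [qpow_two_mul_div]; exact h2) hs hs'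
      (by
        rw [qpow_two_mul_div]
        exact (rhoNorm_qpow_two_mul hη hp₀ hp (mul_ne_zero (Units.ne_zero _) hv₀) h2).symm)
    rwa [qpow_two_mul_div, qpow_neg_two_mul_qpow_two, qpow_two_mul_qpow_two] at h
  | minus =>
    refine traceOp_smul_lax hη hp₀ hp hp' hk (mul_ne_zero (Units.ne_zero _) hv₀)
      (mul_ne_zero (Units.ne_zero _) hv₀) h2 h2' hs hs' (fun s hs hs' => ?_)
      fun s hs hs' => exchange_mixed _ _ hk hz hs hs'
    have h := exchange_rll (W := W) Sgn.minus (qpow η 2 * z₁) z₂ hk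
      (by rw [qpow_two_mul_div]; exact h2) hs hs'
    rw [qpow_two_mul_div] at h
    rwa [qpow_four_mul_qpow_neg_two]

end EllipticB

end

theorem theorem2 (η p : ℂ) (hη : η.re < 0) (hp₀ : p ≠ 0) (hp : ‖p‖ < 1) (W : Set ℂ) :
    (∀ (ε : EllipticB.Sgn) (z₁ z₂ : ℂˣ) (s : ℂ),
      EllipticB.SpecReg η p (z₁ / z₂) → EllipticB.DynReg η p s →
      (∀ μ ∈ W, EllipticB.DynReg η (EllipticB.pstar η p (-2)) (s + μ)) →
      EllipticB.t η p (-2) W z₁ s • EllipticB.lax η p (-2) W ε z₂ s =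
        EllipticB.lax η p (-2) W ε z₂ s *
          Matrix.diagonal fun j => EllipticB.t η p (-2) W z₁ (s + EllipticB.sig j)) ∧
    (‖EllipticB.pstar η p 2‖ < 1 →
      ∀ (ε : EllipticB.Sgn) (z₁ z₂ : ℂˣ) (s : ℂ),
      EllipticB.SpecReg η p (z₁ / z₂) → EllipticB.DynReg η p s →
      (∀ μ ∈ W, EllipticB.DynReg η (EllipticB.pstar η p 2) (s + μ)) →
      EllipticB.tstar η p 2 W z₁ s • EllipticB.lax η p 2 W ε z₂ s =
        EllipticB.lax η p 2 W ε z₂ s *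
          Matrix.diagonal fun j => EllipticB.tstar η p 2 W z₁ (s + EllipticB.sig j)) := by
  exact ⟨fun ε z₁ z₂ s hz hs hs' => EllipticB.t_smul_lax hη hp₀ hp ε z₁ z₂ hz hs hs',
    fun hp' ε z₁ z₂ s hz hs hs' => EllipticB.tstar_smul_lax hη hp₀ hp hp' ε z₁ z₂ hz hs hs'⟩
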